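/- **Theorem 1 (Limiting Distribution and Inference for Sketched LS Estimators).** *Setting.* Let $p\ge 1$ be fixed, $n\to\infty$, $m=m_n\to\infty$ with $m<n$, and let $\tau_{m,n}>0$ satisfy $\tau_{m,n}/m\to 0$. All sequences are indexed by $n\ge n_0$ for some fixed $n_0$. Let $X_n\in\mathbb R^{n\times p}$, $y_n\in\mathbb R^n$ be deterministic, where $X_n$ has full column rank and singular value decomposition $X_n=U_nL_nV_n^\top$: $U_n^\top U_n=I_p$, $V_n$ is orthogonal, and $L_n=\mathrm{diag}(\ell_{n,1},\dots,\ell_{n,p})$ with $\ell_{n,1}\ge\dots\ge\ell_{n,p}>0$. Assume $\limsup_n \ell_{n,1}/\ell_{n,p}<\infty$. Let $S_{m,n}$ be random $m\times n$ matrices. Put $\beta_n=(X_n^\top X_n)^{-1}X_n^\top y_n$, $\varepsilon_n=y_n-X_n\beta_n$, $\bar\varepsilon_n=\varepsilon_n/\|\varepsilon_n\|$, $\overline{X_n\beta_n}=X_n\beta_n/\|X_n\beta_n\|$, $\tilde X_{m,n}=S_{m,n}X_n$, $\tilde y_{m,n}=S_{m,n}y_n$, and $$\hat\beta^{(s)}_{m,n}=(\tilde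 X_{m,n}^\top\tilde X_{m,n})^{-1}\tilde X_{m,n}^\top\tilde y_{m,n},\qquad \hat\beta^{(pa)}_{m,n}=(\tilde X_{m,n}^\top\tilde X_{m,n})^{-1}X_n^\top y_n,\qquad \tilde\varepsilon_{m,n}=\tilde y_{m,n}-\tilde X_{m,n}\hat\beta^{(s)}_{m,n}.$$ *Conditions on quadratic forms.* Let $\mathfrak p$ and $\mathfrak P$ be arbitrary conditions on sequences $(a_n,\tilde a_n)_n$ of pairs of unit vectors of $\mathbb R^n$. - *Bounded:* $\sqrt m\,\tau_{m,n}^{-1/2}(a_n^\top S_{m,n}^\top S_{m,n}\tilde a_n-a_n^\top\tilde a_n)=O_P(1)$ whenever $(a_n,\tilde a_n)_n$ satisfies $\mathfrak p$. - *1-dim:* there is a function $\sigma_n^2(\cdot,\cdot)$ such that, whenever $(a_n,\tilde a_n)_n$ satisfies $\mathfrak P$, the sequence $\sigma_n^2(a_n,\tilde a_n)$ is uniformly bounded away from zero and infinity and $\sqrt m\,\tau_{m,n}^{-1/2}\sigma_n^{-1}(a_n,\tilde a_n)(a_n^\top S_{m,n}^\top S_{m,n}\tilde a_n-a_n^\top\tilde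 a_n)\Rightarrow N(0,1)$. - *1-dim′ with $\alpha\in\{0,1\}$:* 1-dim holds and $\sigma_n^2(a_n,\tilde a_n)=1+(\alpha+1)(a_n^\top\tilde a_n)^2$ for all $n$ and all $(a_n,\tilde a_n)_n$ satisfying $\mathfrak P$. Assume Bounded and 1-dim, and that $(U_nb_n,U_nb_n)_n$ satisfies $\mathfrak P$ for every sequence $(b_n)_n$ of unit vectors of $\mathbb R^p$. *(I) Sketch-and-solve.* Suppose $\varepsilon_n\ne0$ for all $n$, and $(U_nb_n,\bar\varepsilon_n)_n$ satisfies $\mathfrak P$ for every sequence $(b_n)_n$ of unit vectors of $\mathbb R^p$. (a) If $M_n\in\mathbb R^{p\times p}$ are symmetric with $\sigma_n^2(U_nb_n,\bar\varepsilon_n)=b_n^\top M_nb_n$ for all $n$ and all such $(b_n)_n$, then $$m^{1/2}\tau_{m,n}^{-1/2}\left(V_nL_n^{-1}M_nL_n^{-1}V_n^\top\right)^{-1/2}\|\varepsilon_n\|^{-1}(\hat\beta^{(s)}_{m,n}-\beta_n)\Rightarrow N(0,I_p).$$ (b) If 1-dim′ holds for some $\alpha\in\{0,1\}$ and $(\bar\varepsilon_n,\bar\varepsilon_n)_n$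 satisfies $\mathfrak p$, then $$m^{1/2}\tau_{m,n}^{-1/2}\|\tilde\varepsilon_{m,n}\|^{-1}(\tilde X_{m,n}^\top\tilde X_{m,n})^{1/2}(\hat\beta^{(s)}_{m,n}-\beta_n)\Rightarrow N(0,I_p).$$ *(II) Partial sketching.* Suppose $X_n\beta_n\ne0$ for all $n$, and $(U_nb_n,\overline{X_n\beta_n})_n$ satisfies $\mathfrak P$ for every sequence $(b_n)_n$ of unit vectors of $\mathbb R^p$. (a) If $M_n'\in\mathbb R^{p\times p}$ are symmetric with $\sigma_n^2(U_nb_n,\overline{X_n\beta_n})=b_n^\top M_n'b_n$ for all $n$ and all such $(b_n)_n$, then $$m^{1/2}\tau_{m,n}^{-1/2}\left(V_nL_n^{-1}M_n'L_n^{-1}V_n^\top\right)^{-1/2}\|X_n\beta_n\|^{-1}(\hat\beta^{(pa)}_{m,n}-\beta_n)\Rightarrow N(0,I_p).$$ (b) If 1-dim′ holds for some $\alpha\in\{0,1\}$, then $$m^{1/2}\tau_{m,n}^{-1/2}\left(\|\tilde X_{m,n}\hat\beta^{(pa)}_{m,n}\|^2(\tilde X_{m,n}^\top\tilde X_{m,n})^{-1}+(\alpha+1)\hat\beta^{(pa)}_{m,n}\hat\beta^{(pa)\top}_{m,n}\right)^{-1/2}(\hat\beta^{(pa)}_{m,n}-\beta_n)\Rightarrow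 N(0,I_p).$$ Here $A^{1/2}$ is the positive semidefinite square root, $A^{-1/2}$ its inverse, and any convention may be used for the estimators on events where the inverse matrices do not exist (in the formal statement, the inverse of a singular matrix is $0$). -/

import Mathlib

open MeasureTheory ProbabilityTheory Filter Matrix

noncomputable section

namespace SketchedLS

/-- Column vectors of length `k`, with the Euclidean norm. -/
abbrev Vec (k : ℕ) := EuclideanSpace ℝ (Fin k)

/-- A sequence of vectors, the `n`-th one of length `n`. -/
abbrev VecSeq := (n : ℕ) → Vec n

/-- The matrix-vector product `A v`. -/
def mv {k l : ℕ} (A : Matrix (Fin k) (Fin l) ℝ) (v : Vec l) : Vec k :=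
  WithLp.toLp 2 (A *ᵥ v.ofLp)

/-- The least squares coefficient `(Xᵀ X)⁻¹ Xᵀ y`. -/
def lsCoef {n p : ℕ} (X : Matrix (Fin n) (Fin p) ℝ) (y : Vec n) : Vec p :=
  mv ((Xᵀ * X)⁻¹ * Xᵀ) y

/-- The fitted values `X β`, with `β` the least squares coefficient. -/
def fitted {n p : ℕ} (X : Matrix (Fin n) (Fin p) ℝ) (y : Vec n) : Vec n :=
  mv X (lsCoef X y)

/-- The residual `y - X β`, with `β` the least squares coefficient. -/
def residual {n p : ℕ} (X : Matrix (Fin n) (Fin p) ℝ) (y : Vec n) : Vec n :=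
  y - mv X (lsCoef X y)

/-- The normalized vector `v / ‖v‖`. -/
def normalized {k : ℕ} (v : Vec k) : Vec k := ‖v‖⁻¹ • v

/-- The sketch-and-solve estimator: least squares on the sketched data `(S X, S y)`. -/
def sketchSolve {m n p : ℕ} (S : Matrix (Fin m) (Fin n) ℝ) (X : Matrix (Fin n) (Fin p) ℝ)
    (y : Vec n) : Vec p :=
  lsCoef (S * X) (mv S y)

/-- The partial sketching estimator `((S X)ᵀ (S X))⁻¹ Xᵀ y`. -/
def partialSketch {m n p : ℕ} (S : Matrix (Fin m) (Fin n) ℝ) (X : Matrix (Fin n) (Fin p) ℝ)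
    (y : Vec n) : Vec p :=
  mv (((S * X)ᵀ * (S * X))⁻¹ * Xᵀ) y

/-- The positive semidefinite square root of a positive semidefinite matrix. -/
def matSqrt {p : ℕ} (A : Matrix (Fin p) (Fin p) ℝ) : Matrix (Fin p) (Fin p) ℝ :=
  cfc Real.sqrt A

/-- The centred form `aᵀ Sᵀ S b - aᵀ b`. -/
def quadDev {m n : ℕ} (S : Matrix (Fin m) (Fin n) ℝ) (a b : Vec n) : ℝ :=
  a.ofLp ⬝ᵥ ((Sᵀ * S) *ᵥ b.ofLp) - a.ofLp ⬝ᵥ b.ofLp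

/-- `X = U diag(ℓ) Vᵀ` is a (thin) singular value decomposition of an `n × p` matrix of full
column rank: `U` has orthonormal columns, `V` is orthogonal, and the singular values `ℓ` are
positive and listed in non-increasing order. -/
structure IsSVD {n p : ℕ} (X U : Matrix (Fin n) (Fin p) ℝ) (ℓ : Fin p → ℝ)
    (V : Matrix (Fin p) (Fin p) ℝ) : Prop where
  orthU : Uᵀ * U = 1
  orthV : Vᵀ * V = 1
  anti : Antitone ℓ
  pos : ∀ i, 0 < ℓ i
  eq : X = U * diagonal ℓ * Vᵀ

/-- Bounded condition number: `limsup ℓ_{n,1} / ℓ_{n,p} < ∞`. -/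
def BoundedCondNumber {p : ℕ} (hp : 0 < p) (ℓ : ℕ → Fin p → ℝ) : Prop :=
  IsBoundedUnder (· ≤ ·) atTop fun n => ℓ n ⟨0, hp⟩ / ℓ n ⟨p - 1, Nat.sub_lt hp one_pos⟩

/-- All terms from the index `n₀` on (the first index of the asymptotic regime) lie on the unit
sphere. -/
def IsUnitSeq (n₀ : ℕ) (a : VecSeq) : Prop := ∀ n ≥ n₀, ‖a n‖ = 1

/-- `U_n b_n` as a sequence of vectors. -/
def mvSeq {p : ℕ} (U : (n : ℕ) → Matrix (Fin n) (Fin p) ℝ) (b : ℕ → Vec p) : VecSeq :=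
  fun n => mv (U n) (b n)

section Random

variable {Ω : ℕ → Type*} [∀ n, MeasurableSpace (Ω n)]

/-- `Z_n = O_P(1)`. -/
def BoundedInProb (μ : (n : ℕ) → Measure (Ω n)) (Z : (n : ℕ) → Ω n → ℝ) : Prop :=
  ∀ δ : ℝ, 0 < δ → ∃ K : ℝ, ∀ᶠ n in atTop, μ n {ω | K < |Z n ω|} ≤ ENNReal.ofReal δ

/-- `W_n ⇒ N(0, I_p)`. -/
def TendstoStdNormal {p : ℕ} (μ : (n : ℕ) → Measure (Ω n)) [∀ n, IsProbabilityMeasure (μ n)]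
    (W : (n : ℕ) → Ω n → Vec p) : Prop :=
  TendstoInDistribution W atTop id μ (stdGaussian (Vec p))

/-- Boundedness of quadratic forms, for pairs of sequences satisfying the condition `𝔭`. -/
def BoundedForms (n₀ : ℕ) (m : ℕ → ℕ) (τ : ℕ → ℝ) (μ : (n : ℕ) → Measure (Ω n))
    (S : (n : ℕ) → Ω n → Matrix (Fin (m n)) (Fin n) ℝ) (𝔭 : VecSeq → VecSeq → Prop) : Prop :=
  ∀ a b : VecSeq, IsUnitSeq n₀ a → IsUnitSeq n₀ b → 𝔭 a b →
    BoundedInProb μ fun n ω => √(m n : ℝ) * (√(τ n))⁻¹ * quadDev (S n ω) (a n) (b n)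

/-- One-dimensional asymptotic normality of quadratic forms with variance function `σ2`, for pairs
of sequences satisfying the condition `𝔓`: along each of them the variances are bounded away from
zero and infinity, and the studentized centred forms converge weakly to `N(0, 1)`. -/
def OneDimForms (n₀ : ℕ) (m : ℕ → ℕ) (τ : ℕ → ℝ) (μ : (n : ℕ) → Measure (Ω n))
    [∀ n, IsProbabilityMeasure (μ n)]
    (S : (n : ℕ) → Ω n → Matrix (Fin (m n)) (Fin n) ℝ) (𝔓 : VecSeq → VecSeq → Prop)
    (σ2 : (n : ℕ) → Vec n → Vec n → ℝ) : Prop :=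
  ∀ a b : VecSeq, IsUnitSeq n₀ a → IsUnitSeq n₀ b → 𝔓 a b →
    (∃ c C : ℝ, 0 < c ∧ ∀ n ≥ n₀, c ≤ σ2 n (a n) (b n) ∧ σ2 n (a n) (b n) ≤ C) ∧
    TendstoInDistribution
      (fun n ω => √(m n : ℝ) * (√(τ n))⁻¹ * (√(σ2 n (a n) (b n)))⁻¹ *
        quadDev (S n ω) (a n) (b n))
      atTop id μ (gaussianReal 0 1)

end Random

/-- `M_n` is the symmetric matrix of the variance function along `U_n` and `e_n`:
`σ_n²(U_n b_n, e_n) = b_nᵀ M_n b_n` for all unit vectors `b_n` for which `(U_n b_n, e_n)` satisfies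
the condition `𝔓`. -/
def IsVarianceMatrix {p : ℕ} (n₀ : ℕ) (𝔓 : VecSeq → VecSeq → Prop)
    (σ2 : (n : ℕ) → Vec n → Vec n → ℝ) (U : (n : ℕ) → Matrix (Fin n) (Fin p) ℝ) (e : VecSeq)
    (M : ℕ → Matrix (Fin p) (Fin p) ℝ) : Prop :=
  (∀ n ≥ n₀, (M n).IsSymm) ∧
    ∀ b : ℕ → Vec p, (∀ n, ‖b n‖ = 1) → 𝔓 (mvSeq U b) e →
      ∀ n ≥ n₀, σ2 n (mv (U n) (b n)) (e n) = (b n).ofLp ⬝ᵥ (M n *ᵥ (b n).ofLp)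

/-- The special variance form `σ_n²(a_n, b_n) = 1 + (α + 1) (a_nᵀ b_n)²`. -/
def SpecialVariance (n₀ : ℕ) (𝔓 : VecSeq → VecSeq → Prop)
    (σ2 : (n : ℕ) → Vec n → Vec n → ℝ) (α : ℝ) : Prop :=
  ∀ a b : VecSeq, IsUnitSeq n₀ a → IsUnitSeq n₀ b → 𝔓 a b →
    ∀ n ≥ n₀, σ2 n (a n) (b n) = 1 + (α + 1) * ((a n).ofLp ⬝ᵥ (b n).ofLp) ^ 2

/-- The outer product `v vᵀ`. -/
def outer {p : ℕ} (v : Vec p) : Matrix (Fin p) (Fin p) ℝ := vecMulVec v.ofLp v.ofLp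

/-- The covariance `V L⁻¹ M L⁻¹ Vᵀ`, with `L = diag(ℓ)`. -/
def limitCov {p : ℕ} (V : Matrix (Fin p) (Fin p) ℝ) (ℓ : Fin p → ℝ)
    (M : Matrix (Fin p) (Fin p) ℝ) : Matrix (Fin p) (Fin p) ℝ :=
  V * (diagonal ℓ)⁻¹ * M * (diagonal ℓ)⁻¹ * Vᵀ

end SketchedLS

end

noncomputable section

namespace SketchedLS

/-! Choose `T` invertible and `θ ≠ 0` with `X T = θ U`, and put `G = Uᵀ Sᵀ S U` and `d = Uᵀ (Sᵀ S e
- e)`, where `e` is the normalized residual for sketch-and-solve and the normalized fit for partial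
sketching. Where `G` is invertible, the estimation error is exactly a scalar times `T G⁻¹ d`
(`sketchSolve_sub_lsCoef`, `partialSketch_sub_lsCoef`). The scalar cancels against the square root
of the covariance, so all four statements say that `(T N Tᵀ)^{-1/2} T G⁻¹ z` is asymptotically
standard normal, where `z = √(m/τ) d` and `N` is the variance matrix `M` or a random approximation
of it.

In the ideal case `N = M`, `G = 1`, the matrix `A = (T M Tᵀ)^{-1/2} T` satisfies `A M Aᵀ = 1`. For
fixed `t`, `⟨A z, t⟩ = ⟨z, Aᵀ t⟩` is then `‖t‖` times a studentized quadratic form in the direction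
of `Aᵀ t`. The one-dimensional assumption covers arbitrary sequences of unit vectors, hence this
moving direction, and characteristic functions give the limit (`tendstoStdNormal_mv`). Neither `T`
nor `M` has to converge.

Slutsky's lemma then passes from `(M, 1)` to `(N, G)`. In probability `G → 1` and `N - M → 0`, while
`z` is bounded. With `|θ| = ℓ₁`, the bounded condition number keeps `T` in a compact set of
invertible matrices, and the variance bounds do the same for `M`. Hence the normalizing matrix is
uniformly continuous where it is needed (`tendsto_studentizer_sub`), and
`tendstoStdNormal_of_eq_studentizer` follows. -/

/-! ### Positive semidefinite square roots -/

open scoped MatrixOrder in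
lemma matSqrt_posSemidef {p : ℕ} (A : Matrix (Fin p) (Fin p) ℝ) : (matSqrt A).PosSemidef := by
  rw [← Matrix.nonneg_iff_posSemidef]
  exact cfc_nonneg fun x _ => Real.sqrt_nonneg x

open scoped MatrixOrder in
lemma matSqrt_mul_self {p : ℕ} {A : Matrix (Fin p) (Fin p) ℝ} (hA : A.PosSemidef) :
    matSqrt A * matSqrt A = A := by
  have hsa : IsSelfAdjoint A := hA.1
  have h0 : 0 ≤ A := Matrix.nonneg_iff_posSemidef.2 hA
  unfold matSqrt
  rw [← cfc_mul Real.sqrt Real.sqrt A]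
  conv_rhs => rw [← cfc_id ℝ A]
  refine cfc_congr fun x hx => ?_
  exact Real.mul_self_sqrt (spectrum_nonneg_of_nonneg h0 hx)

-- Uniqueness of the root: `A` is the square function applied to `B`, and `√(x²) = x` on the
-- nonnegative spectrum of `B`.
open scoped MatrixOrder in
lemma matSqrt_eq_of_mul_self {p : ℕ} {A B : Matrix (Fin p) (Fin p) ℝ} (hB : B.PosSemidef)
    (h : B * B = A) : matSqrt A = B := by
  have hsa : IsSelfAdjoint B := hB.1
  have h0 : 0 ≤ B := Matrix.nonneg_iff_posSemidef.2 hB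
  unfold matSqrt
  have : A = cfc (fun x : ℝ => x * x) B := by
    rw [cfc_mul (fun x : ℝ => x) (fun x : ℝ => x) B, cfc_id' ℝ B, h]
  rw [this, ← cfc_comp' Real.sqrt (fun x : ℝ => x * x) B]
  conv_rhs => rw [← cfc_id ℝ B]
  refine cfc_congr fun x hx => ?_
  exact Real.sqrt_mul_self (spectrum_nonneg_of_nonneg h0 hx)

lemma matSqrt_sq_smul {p : ℕ} {A : Matrix (Fin p) (Fin p) ℝ} (hA : A.PosSemidef) {k : ℝ}
    (hk : 0 ≤ k) : matSqrt (k ^ 2 • A) = k • matSqrt A := by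
  refine matSqrt_eq_of_mul_self ((matSqrt_posSemidef A).smul hk) ?_
  rw [smul_mul_smul_comm, matSqrt_mul_self hA, sq]

lemma matSqrt_inv {p : ℕ} {A : Matrix (Fin p) (Fin p) ℝ} (hA : A.PosSemidef) :
    matSqrt A⁻¹ = (matSqrt A)⁻¹ := by
  refine matSqrt_eq_of_mul_self (matSqrt_posSemidef A).inv ?_
  rw [← Matrix.mul_inv_rev, matSqrt_mul_self hA]

/-- The square root of the symmetric part, a continuous extension of `matSqrt`. -/
def symSqrt {p : ℕ} (A : Matrix (Fin p) (Fin p) ℝ) : Matrix (Fin p) (Fin p) ℝ :=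
  matSqrt ((2 : ℝ)⁻¹ • (A + Aᵀ))

lemma transpose_eq_of_isHermitian {p : ℕ} {A : Matrix (Fin p) (Fin p) ℝ} (hA : A.IsHermitian) :
    Aᵀ = A := by
  rw [← Matrix.conjTranspose_eq_transpose_of_trivial]
  exact hA

lemma symSqrt_eq_matSqrt {p : ℕ} {A : Matrix (Fin p) (Fin p) ℝ} (hA : Aᵀ = A) :
    symSqrt A = matSqrt A := by
  rw [symSqrt, hA, ← two_smul ℝ A, smul_smul]
  norm_num

lemma continuous_symmetricPart {p : ℕ} :
    Continuous fun A : Matrix (Fin p) (Fin p) ℝ => (2 : ℝ)⁻¹ • (A + Aᵀ) := by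
  have h : Continuous fun A : Matrix (Fin p) (Fin p) ℝ => A + Aᵀ :=
    continuous_id.add continuous_id.matrix_transpose
  exact h.const_smul (2 : ℝ)⁻¹

-- The symmetric part is self-adjoint for every argument, so continuity of the functional calculus
-- applies on the whole matrix space and not only on the semidefinite cone.
open scoped Matrix.Norms.L2Operator in
lemma continuous_symSqrt {p : ℕ} :
    Continuous (symSqrt : Matrix (Fin p) (Fin p) ℝ → Matrix (Fin p) (Fin p) ℝ) := by
  unfold symSqrt matSqrt
  have hs : ∀ A : Matrix (Fin p) (Fin p) ℝ, IsSelfAdjoint ((2 : ℝ)⁻¹ • (A + Aᵀ)) := by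
    intro A
    show Matrix.conjTranspose _ = _
    rw [Matrix.conjTranspose_eq_transpose_of_trivial]
    simp [add_comm]
  exact Continuous.cfc_of_mem_nhdsSet (s := Set.univ) Real.sqrt (by simp)
    continuous_symmetricPart hs
    Real.continuous_sqrt.continuousOn

/-! ### The normalizing matrix and its uniform continuity -/

/-- The matrix `(T M Tᵀ)^{-1/2} T G⁻¹`. -/
def studentizer {p : ℕ} (T M G : Matrix (Fin p) (Fin p) ℝ) : Matrix (Fin p) (Fin p) ℝ :=
  (symSqrt (T * M * Tᵀ))⁻¹ * T * G⁻¹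

lemma posSemidef_conj {p : ℕ} {M : Matrix (Fin p) (Fin p) ℝ} (hM : M.PosSemidef)
    (T : Matrix (Fin p) (Fin p) ℝ) : (T * M * Tᵀ).PosSemidef := by
  simpa using hM.mul_mul_conjTranspose_same T

lemma symSqrt_conj_mul_self {p : ℕ} {M : Matrix (Fin p) (Fin p) ℝ} (hM : M.PosSemidef)
    (T : Matrix (Fin p) (Fin p) ℝ) :
    symSqrt (T * M * Tᵀ) * symSqrt (T * M * Tᵀ) = T * M * Tᵀ := by
  have h := posSemidef_conj hM T
  rw [symSqrt_eq_matSqrt (transpose_eq_of_isHermitian h.1), matSqrt_mul_self h]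

lemma isUnit_det_symSqrt_conj {p : ℕ} {T M : Matrix (Fin p) (Fin p) ℝ} (hM : M.PosDef)
    (hT : T.det ≠ 0) : (symSqrt (T * M * Tᵀ)).det ≠ 0 := by
  intro h
  have := congrArg Matrix.det (symSqrt_conj_mul_self hM.posSemidef T)
  simp only [Matrix.det_mul, h, Matrix.det_transpose, mul_zero] at this
  have := hM.det_pos.ne'
  simp_all

lemma studentizer_mul_mul_transpose {p : ℕ} {T M : Matrix (Fin p) (Fin p) ℝ} (hM : M.PosDef)
    (hT : T.det ≠ 0) : studentizer T M 1 * M * (studentizer T M 1)ᵀ = 1 := by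
  have h := isUnit_det_symSqrt_conj hM hT
  have hs : (symSqrt (T * M * Tᵀ))ᵀ = symSqrt (T * M * Tᵀ) :=
    transpose_eq_of_isHermitian (matSqrt_posSemidef _).1
  have hu : IsUnit (symSqrt (T * M * Tᵀ)).det := isUnit_iff_ne_zero.2 h
  unfold studentizer
  rw [inv_one, mul_one, Matrix.transpose_mul, Matrix.transpose_nonsing_inv, hs]
  calc _ = (symSqrt (T * M * Tᵀ))⁻¹ * (T * M * Tᵀ) * (symSqrt (T * M * Tᵀ))⁻¹ := by
        simp only [Matrix.mul_assoc]
    _ = 1 := by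
        nth_rewrite 2 [← symSqrt_conj_mul_self hM.posSemidef T]
        rw [← Matrix.mul_assoc, Matrix.nonsing_inv_mul _ hu, Matrix.one_mul,
          Matrix.mul_nonsing_inv _ hu]

lemma continuousAt_matrix_inv {p : ℕ} {A : Matrix (Fin p) (Fin p) ℝ} (hA : A.det ≠ 0) :
    ContinuousAt (fun A : Matrix (Fin p) (Fin p) ℝ => A⁻¹) A := by
  simp only [Matrix.inv_def, Ring.inverse_eq_inv']
  exact (ContinuousAt.inv₀ continuous_id.matrix_det.continuousAt hA).smul
    continuous_id.matrix_adjugate.continuousAt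

lemma continuousAt_studentizer {p : ℕ} {T M G : Matrix (Fin p) (Fin p) ℝ} (hM : M.PosDef)
    (hT : T.det ≠ 0) (hG : G.det ≠ 0) :
    ContinuousAt (fun x : Matrix (Fin p) (Fin p) ℝ × Matrix (Fin p) (Fin p) ℝ ×
      Matrix (Fin p) (Fin p) ℝ => studentizer x.1 x.2.1 x.2.2) (T, M, G) := by
  unfold studentizer
  have hmul : Continuous fun x : Matrix (Fin p) (Fin p) ℝ × Matrix (Fin p) (Fin p) ℝ =>
    x.1 * x.2 := continuous_fst.matrix_mul continuous_snd
  refine hmul.continuousAt.comp₂ (hmul.continuousAt.comp₂ ?_ continuousAt_fst) ?_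
  · refine ContinuousAt.comp (g := fun A : Matrix (Fin p) (Fin p) ℝ => A⁻¹)
      (continuousAt_matrix_inv (isUnit_det_symSqrt_conj hM hT)) ?_
    exact (continuous_symSqrt.comp (by fun_prop)).continuousAt
  · exact ContinuousAt.comp (g := fun A : Matrix (Fin p) (Fin p) ℝ => A⁻¹)
      (continuousAt_matrix_inv hG) (continuous_snd.snd).continuousAt

/-- Invertible scale matrices `T`, uniformly positive definite bounded `M`, and `G = 1`. -/
def studentizerDomain (p : ℕ) (κ c C : ℝ) : Set (Matrix (Fin p) (Fin p) ℝ ×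
    Matrix (Fin p) (Fin p) ℝ × Matrix (Fin p) (Fin p) ℝ) :=
  {x | (∀ i j, |x.1 i j| ≤ κ) ∧ 1 ≤ |x.1.det| ∧ x.2.1ᵀ = x.2.1 ∧ (∀ i j, |x.2.1 i j| ≤ C) ∧
    (∀ v : Fin p → ℝ, c * (v ⬝ᵥ v) ≤ v ⬝ᵥ (x.2.1 *ᵥ v)) ∧ x.2.2 = 1}

/-- A closed subset of a box. Invertibility enters as `1 ≤ |det T|` and definiteness with a fixed
constant `c`, so that both conditions are closed. -/
lemma isCompact_studentizerDomain (p : ℕ) (κ c C : ℝ) :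
    IsCompact (studentizerDomain p κ c C) := by
  have hbox : ∀ K : ℝ, IsCompact {A : Matrix (Fin p) (Fin p) ℝ | ∀ i j, |A i j| ≤ K} := by
    intro K
    have h : IsCompact (Set.univ.pi fun _ : Fin p => Set.univ.pi fun _ : Fin p => Set.Icc (-K) K) :=
      isCompact_univ_pi fun _ => isCompact_univ_pi fun _ => isCompact_Icc
    have h2 : {A : Matrix (Fin p) (Fin p) ℝ | ∀ i j, |A i j| ≤ K} =
        Set.univ.pi fun _ : Fin p => Set.univ.pi fun _ : Fin p => Set.Icc (-K) K := by
      refine Set.ext fun A => ?_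
      simp only [Set.mem_ofPred_eq, abs_le]
      exact ⟨fun h i _ j _ => h i j, fun h i j => h i trivial j trivial⟩
    rw [h2]
    exact h
  refine ((hbox κ).prod ((hbox C).prod (isCompact_singleton
    (x := (1 : Matrix (Fin p) (Fin p) ℝ))))).of_isClosed_subset ?_ ?_
  · simp only [studentizerDomain, Set.ofPred_and, Set.ofPred_forall]
    refine IsClosed.inter ?_ (IsClosed.inter ?_ (IsClosed.inter ?_ (IsClosed.inter ?_
      (IsClosed.inter ?_ ?_))))
    · exact isClosed_iInter fun i => isClosed_iInter fun j =>
        isClosed_le ((continuous_fst.matrix_elem i j).abs) continuous_const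
    · exact isClosed_le continuous_const continuous_fst.matrix_det.abs
    · exact isClosed_eq continuous_snd.fst.matrix_transpose continuous_snd.fst
    · exact isClosed_iInter fun i => isClosed_iInter fun j =>
        isClosed_le ((continuous_snd.fst.matrix_elem i j).abs) continuous_const
    · exact isClosed_iInter fun v => isClosed_le continuous_const
        (continuous_const.dotProduct (continuous_snd.fst.matrix_mulVec continuous_const))
    · exact isClosed_eq continuous_snd.snd continuous_const
  · rintro ⟨T, M, G⟩ ⟨h1, -, -, h2, -, h3⟩
    exact ⟨h1, h2, h3⟩

lemma posDef_of_coercive {p : ℕ} {M : Matrix (Fin p) (Fin p) ℝ} {c : ℝ} (hc : 0 < c)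
    (hM : Mᵀ = M) (h : ∀ v : Fin p → ℝ, c * (v ⬝ᵥ v) ≤ v ⬝ᵥ (M *ᵥ v)) : M.PosDef := by
  refine Matrix.PosDef.of_dotProduct_mulVec_pos (by simpa [Matrix.IsHermitian] using hM) ?_
  intro v hv
  have : 0 < v ⬝ᵥ v := by
    simpa using Matrix.dotProduct_star_self_pos_iff.2 hv
  simpa using (mul_pos hc this).trans_le (h v)

/-- If `x` stays in a compact set on which `F` is continuous and `y` approaches `x`, then `F y`
approaches `F x`. -/
lemma tendsto_uniformity_of_isCompact {α E E' : Type*} [UniformSpace E] [UniformSpace E']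
    {l : Filter α} {K : Set E} (hK : IsCompact K) {F : E → E'} (hF : ∀ x ∈ K, ContinuousAt F x)
    {x y : α → E} (hx : ∀ᶠ s in l, x s ∈ K)
    (hxy : Tendsto (fun s => (x s, y s)) l (uniformity E)) :
    Tendsto (fun s => (F (x s), F (y s))) l (uniformity E') := by
  intro r hr
  -- This uniformity holds around the points of `K`; only `x` has to lie in `K`, while `y` may leave
  -- it.
  have hu := hK.uniformContinuousAt_of_continuousAt _ hF hr
  have h : ∀ᶠ s in l, (F (x s), F (y s)) ∈ r := by
    filter_upwards [hx, hxy.eventually hu] with s hs h2 using h2 hs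
  exact h

/-- None of `T`, `M`, `N` has to converge: compactness makes the replacement of `(M, 1)` by `(N, G)`
uniform. -/
lemma tendsto_studentizer_sub {p : ℕ} {α : Type*} {l : Filter α} {κ c C : ℝ} (hc : 0 < c)
    {T M N G : α → Matrix (Fin p) (Fin p) ℝ}
    (hK : ∀ᶠ s in l, (T s, M s, 1) ∈ studentizerDomain p κ c C)
    (hN : Tendsto (fun s => N s - M s) l (nhds 0)) (hG : Tendsto G l (nhds 1)) :
    Tendsto (fun s => studentizer (T s) (N s) (G s) - studentizer (T s) (M s) 1) l (nhds 0) := by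
  have key : Tendsto (fun s => (studentizer (T s) (M s) 1, studentizer (T s) (N s) (G s))) l
      (uniformity _) := by
    have hcont : ∀ x ∈ studentizerDomain p κ c C,
        ContinuousAt (fun x : Matrix (Fin p) (Fin p) ℝ × Matrix (Fin p) (Fin p) ℝ ×
          Matrix (Fin p) (Fin p) ℝ => studentizer x.1 x.2.1 x.2.2) x := by
      rintro ⟨T, M, G⟩ ⟨-, h1, h2, -, h3, h4⟩
      refine continuousAt_studentizer (posDef_of_coercive hc h2 h3) ?_ ?_
      · intro h
        dsimp at h1
        rw [h] at h1; norm_num at h1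
      · dsimp at h4; simp [h4]
    have hxy : Tendsto (fun s => ((T s, M s, (1 : Matrix (Fin p) (Fin p) ℝ)), (T s, N s, G s))) l
        (uniformity _) := by
      rw [uniformity_eq_comap_nhds_zero, tendsto_comap_iff]
      have h1 : Tendsto (fun s => G s - 1) l (nhds 0) := by
        simpa using hG.sub_const 1
      have := (tendsto_const_nhds (x := (0 : Matrix (Fin p) (Fin p) ℝ)) (f := l)).prodMk_nhds
        (hN.prodMk_nhds h1)
      refine this.congr fun s => ?_
      simp
    exact tendsto_uniformity_of_isCompact
      (F := fun x : Matrix (Fin p) (Fin p) ℝ × Matrix (Fin p) (Fin p) ℝ ×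
        Matrix (Fin p) (Fin p) ℝ => studentizer x.1 x.2.1 x.2.2)
      (x := fun s => (T s, M s, 1)) (y := fun s => (T s, N s, G s))
      (isCompact_studentizerDomain p κ c C) hcont hK hxy
  rw [uniformity_eq_comap_nhds_zero, tendsto_comap_iff] at key
  exact key

/-! ### Convergence in probability and in law on varying probability spaces -/

section Prob

variable {Ω : ℕ → Type*} [∀ n, MeasurableSpace (Ω n)]

/-- The filter of events whose probability tends to one: convergence along it is convergence in
probability. -/
def probFilter (μ : (n : ℕ) → Measure (Ω n)) : Filter (Σ n, Ω n) where
  sets := {E | Tendsto (fun n => μ n {ω | (⟨n, ω⟩ : Σ n, Ω n) ∉ E}) atTop (nhds 0)}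
  univ_sets := by simp
  sets_of_superset {E F} hE hEF := tendsto_of_tendsto_of_tendsto_of_le_of_le tendsto_const_nhds hE
    (fun _ => zero_le) fun n => measure_mono fun ω h h' => h (hEF h')
  inter_sets {E F} hE hF := by
    have h := Tendsto.add hE hF
    rw [add_zero] at h
    refine tendsto_of_tendsto_of_tendsto_of_le_of_le tendsto_const_nhds h
      (fun _ => zero_le) fun n => ?_
    refine (measure_mono ?_).trans (measure_union_le _ _)
    intro ω h
    simp only [Set.mem_ofPred_eq, Set.mem_inter_iff, Set.mem_union] at h ⊢
    tauto

variable {μ : (n : ℕ) → Measure (Ω n)}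

lemma eventually_probFilter {P : (Σ n, Ω n) → Prop} :
    (∀ᶠ s in probFilter μ, P s) ↔
      Tendsto (fun n => μ n {ω | ¬ P ⟨n, ω⟩}) atTop (nhds 0) := Iff.rfl

lemma tendsto_fst_probFilter : Tendsto Sigma.fst (probFilter μ) atTop := by
  intro E hE
  refine (tendsto_const_nhds (x := (0 : ENNReal))).congr' ?_
  filter_upwards [hE] with n hn
  simp [hn]

lemma BoundedInProb.mul_tendsto_zero {Z : (n : ℕ) → Ω n → ℝ} (hZ : BoundedInProb μ Z)
    {Y : (Σ n, Ω n) → ℝ} (hY : Tendsto Y (probFilter μ) (nhds 0)) :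
    Tendsto (fun s => Z s.1 s.2 * Y s) (probFilter μ) (nhds 0) := by
  rw [Metric.tendsto_nhds] at hY ⊢
  intro ε hε
  rw [eventually_probFilter, ENNReal.tendsto_nhds_zero]
  intro δ hδ
  obtain ⟨r, hr0, hr⟩ := ENNReal.lt_iff_exists_nnreal_btwn.1 (ENNReal.half_pos hδ.ne')
  obtain ⟨K, hK⟩ := hZ r (by simpa using hr0)
  -- `K` may be negative or zero, hence the positive denominator `|K| + 1`.
  have hY' := hY (ε / (|K| + 1)) (by positivity)
  rw [eventually_probFilter, ENNReal.tendsto_nhds_zero] at hY'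
  filter_upwards [hK, hY' _ (ENNReal.half_pos hδ.ne')] with n h1 h2
  rw [ENNReal.ofReal_coe_nnreal] at h1
  calc _ ≤ μ n ({ω | K < |Z n ω|} ∪ {ω | ¬ dist (Y ⟨n, ω⟩) 0 < ε / (|K| + 1)}) := by
        refine measure_mono fun ω h => ?_
        simp only [Set.mem_ofPred_eq, Set.mem_union, dist_zero_right, Real.norm_eq_abs, not_lt,
          abs_mul] at h ⊢
        by_contra! hcon
        obtain ⟨ha, hb⟩ := hcon
        rw [lt_div_iff₀ (by positivity)] at hb
        nlinarith [abs_nonneg (Y ⟨n, ω⟩), le_abs_self K]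
    _ ≤ _ := measure_union_le _ _
    _ ≤ δ / 2 + δ / 2 := add_le_add (h1.trans hr.le) h2
    _ = δ := ENNReal.add_halves δ

lemma BoundedInProb.mul_bounded {Z : (n : ℕ) → Ω n → ℝ} (hZ : BoundedInProb μ Z)
    {s : ℕ → ℝ} {C : ℝ} (hs : ∀ᶠ n in atTop, |s n| ≤ C) :
    BoundedInProb μ fun n ω => s n * Z n ω := by
  intro δ hδ
  obtain ⟨K, hK⟩ := hZ δ hδ
  refine ⟨|C| * |K|, ?_⟩
  filter_upwards [hK, hs] with n h1 h2
  refine (measure_mono fun ω h => ?_).trans h1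
  simp only [Set.mem_ofPred_eq, abs_mul] at h ⊢
  by_contra! hcon
  have := mul_le_mul (h2.trans (le_abs_self C)) (hcon.trans (le_abs_self K)) (abs_nonneg _)
    (abs_nonneg _)
  linarith

lemma BoundedInProb.congr {Z Z' : (n : ℕ) → Ω n → ℝ} (hZ : BoundedInProb μ Z)
    (h : ∀ᶠ n in atTop, Z n = Z' n) : BoundedInProb μ Z' := by
  intro δ hδ
  obtain ⟨K, hK⟩ := hZ δ hδ
  refine ⟨K, ?_⟩
  filter_upwards [hK, h] with n h1 h2
  rwa [← h2]

variable [∀ n, IsProbabilityMeasure (μ n)]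

lemma boundedInProb_of_tendstoInDistribution {Z : (n : ℕ) → Ω n → ℝ} {ν : Measure ℝ}
    [IsProbabilityMeasure ν] (h : TendstoInDistribution Z atTop id μ ν) : BoundedInProb μ Z := by
  intro δ hδ
  have htight := tendsto_measure_norm_gt_of_isTightMeasureSet (isTightMeasureSet_singleton (μ := ν))
  simp only [Set.mem_singleton_iff, iSup_iSup_eq_left] at htight
  obtain ⟨K, hK⟩ := (htight.eventually_lt_const (ENNReal.ofReal_pos.2 hδ)).exists
  -- The portmanteau inequality needs a closed tail; `{K + 1 ≤ |x|}` is one inside the open tail `{K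
  -- < |x|}` controlled by tightness.
  refine ⟨K + 1, ?_⟩
  have hcl : IsClosed {x : ℝ | K + 1 ≤ |x|} := isClosed_le continuous_const continuous_abs
  have hlim := ProbabilityMeasure.limsup_measure_closed_le_of_tendsto h.tendsto hcl
  have hlt : limsup (fun n => (μ n).map (Z n) {x : ℝ | K + 1 ≤ |x|}) atTop < ENNReal.ofReal δ := by
    refine lt_of_le_of_lt hlim (lt_of_le_of_lt ?_ hK)
    simp only [ProbabilityMeasure.coe_mk, Measure.map_id]
    refine measure_mono fun x hx => ?_
    simp only [Set.mem_ofPred_eq, Real.norm_eq_abs] at hx ⊢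
    linarith
  filter_upwards [eventually_lt_of_limsup_lt hlt] with n hn
  rw [Measure.map_apply_of_aemeasurable (h.forall_aemeasurable n) hcl.measurableSet] at hn
  refine (measure_mono fun ω hω => ?_).trans hn.le
  exact le_of_lt (show K + 1 < |Z n ω| from hω)

/-- Bounded convergence in probability: the integrand is below `r` off an event of vanishing
probability and at most `2` on it. The bound `2` suits a difference of two numbers of modulus one.
-/
lemma tendsto_integral_zero_of_tendsto_probFilter {Z : (n : ℕ) → Ω n → ℂ}
    (hb : ∀ n ω, ‖Z n ω‖ ≤ 2)
    (hZ : Tendsto (fun s : Σ n, Ω n => Z s.1 s.2) (probFilter μ) (nhds 0)) :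
    Tendsto (fun n => ∫ ω, Z n ω ∂(μ n)) atTop (nhds 0) := by
  rw [tendsto_zero_iff_enorm_tendsto_zero, ENNReal.tendsto_nhds_zero]
  intro δ hδ
  obtain ⟨r, hr0, hr⟩ := ENNReal.lt_iff_exists_nnreal_btwn.1 (ENNReal.half_pos hδ.ne')
  have hr0' : (0 : ℝ) < r := by simpa using hr0
  have h1 := (Metric.tendsto_nhds.1 hZ) r hr0'
  rw [eventually_probFilter] at h1
  have h2 := ENNReal.Tendsto.const_mul (a := 2) h1 (Or.inr (by simp))
  rw [mul_zero, ENNReal.tendsto_nhds_zero] at h2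
  filter_upwards [h2 _ (ENNReal.half_pos hδ.ne')] with n hn
  set E : Set (Ω n) := {ω | ¬ dist (Z n ω) 0 < (r : ℝ)} with hE
  calc ‖∫ ω, Z n ω ∂(μ n)‖ₑ ≤ ∫⁻ ω, ‖Z n ω‖ₑ ∂(μ n) := enorm_integral_le_lintegral_enorm _
    _ ≤ ∫⁻ ω, (r : ENNReal) + E.indicator (fun _ => 2) ω ∂(μ n) := by
        refine lintegral_mono fun ω => ?_
        by_cases hω : ω ∈ E
        · rw [Set.indicator_of_mem hω]
          refine le_trans ?_ le_add_self
          rw [← ofReal_norm]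
          exact (ENNReal.ofReal_le_ofReal (hb n ω)).trans (by simp)
        · rw [Set.indicator_of_notMem hω, add_zero, ← ofReal_norm]
          simp only [hE, Set.mem_ofPred_eq, not_not, dist_zero_right] at hω
          exact (ENNReal.ofReal_le_ofReal hω.le).trans (by simp)
    _ ≤ r + 2 * μ n E := by
        rw [lintegral_add_left measurable_const]
        refine add_le_add (by simp) (lintegral_indicator_const_le _ _)
    _ ≤ δ / 2 + δ / 2 := add_le_add hr.le hn
    _ = δ := ENNReal.add_halves δ

lemma norm_exp_mul_I_sub_exp_mul_I_le (a b : ℝ) :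
    ‖Complex.exp (a * Complex.I) - Complex.exp (b * Complex.I)‖ ≤ |a - b| := by
  have h : Complex.exp (a * Complex.I) - Complex.exp (b * Complex.I) =
      Complex.exp (b * Complex.I) * (Complex.exp (Complex.I * ((a - b : ℝ) : ℂ)) - 1) := by
    rw [mul_sub, ← Complex.exp_add, mul_one]
    congr 2
    push_cast
    ring
  rw [h, norm_mul, Complex.norm_exp_ofReal_mul_I, one_mul]
  exact Real.norm_exp_I_mul_ofReal_sub_one_le

lemma tendstoStdNormal_iff {p : ℕ} {W : (n : ℕ) → Ω n → Vec p}
    (hW : ∀ n, AEMeasurable (W n) (μ n)) :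
    TendstoStdNormal μ W ↔ ∀ t : Vec p,
      Tendsto (fun n => ∫ ω, Complex.exp ((inner ℝ (W n ω) t : ℝ) * Complex.I) ∂(μ n)) atTop
        (nhds (Complex.exp (-‖t‖ ^ 2 / 2))) := by
  have key : ∀ (n : ℕ) (t : Vec p), charFun ((μ n).map (W n)) t =
      ∫ ω, Complex.exp ((inner ℝ (W n ω) t : ℝ) * Complex.I) ∂(μ n) := by
    intro n t
    rw [charFun_apply, integral_map (hW n)]
    exact Measurable.aestronglyMeasurable (by fun_prop)
  have key2 : ∀ t : Vec p, charFun ((stdGaussian (Vec p)).map id) t =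
      Complex.exp (-‖t‖ ^ 2 / 2) := by
    intro t
    rw [Measure.map_id, charFun_stdGaussian]
  constructor
  · intro h t
    have := (ProbabilityMeasure.tendsto_iff_tendsto_charFun.1 h.tendsto) t
    simpa only [ProbabilityMeasure.coe_mk, key, key2] using this
  · intro h
    refine ⟨hW, aemeasurable_id, ?_⟩
    refine ProbabilityMeasure.tendsto_iff_tendsto_charFun.2 fun t => ?_
    simpa only [ProbabilityMeasure.coe_mk, key, key2] using h t

/-- Slutsky's lemma on varying probability spaces. -/
lemma TendstoStdNormal.of_tendsto_sub {p : ℕ} {W W' : (n : ℕ) → Ω n → Vec p}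
    (h : TendstoStdNormal μ W) (hW' : ∀ n, AEMeasurable (W' n) (μ n))
    (hsub : Tendsto (fun s : Σ n, Ω n => W' s.1 s.2 - W s.1 s.2) (probFilter μ) (nhds 0)) :
    TendstoStdNormal μ W' := by
  have hW : ∀ n, AEMeasurable (W n) (μ n) := h.forall_aemeasurable
  rw [tendstoStdNormal_iff hW']
  rw [tendstoStdNormal_iff hW] at h
  intro t
  have hint : ∀ (V : (n : ℕ) → Ω n → Vec p), (∀ n, AEMeasurable (V n) (μ n)) → ∀ n,
      Integrable (fun ω => Complex.exp ((inner ℝ (V n ω) t : ℝ) * Complex.I)) (μ n) := by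
    intro V hV n
    refine Integrable.of_bound (C := 1) ?_ ?_
    · have : Measurable fun v : Vec p => Complex.exp ((inner ℝ v t : ℝ) * Complex.I) := by fun_prop
      exact (this.comp_aemeasurable (hV n)).aestronglyMeasurable
    · exact Filter.Eventually.of_forall fun ω => (Complex.norm_exp_ofReal_mul_I _).le
  have hdiff : Tendsto (fun n => ∫ ω, (Complex.exp ((inner ℝ (W' n ω) t : ℝ) * Complex.I) -
      Complex.exp ((inner ℝ (W n ω) t : ℝ) * Complex.I)) ∂(μ n)) atTop (nhds 0) := by
    refine tendsto_integral_zero_of_tendsto_probFilter (fun n ω => ?_) ?_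
    · refine (norm_sub_le _ _).trans ?_
      rw [Complex.norm_exp_ofReal_mul_I, Complex.norm_exp_ofReal_mul_I]
      norm_num
    · have h0 : Tendsto (fun s : Σ n, Ω n => ‖W' s.1 s.2 - W s.1 s.2‖ * ‖t‖) (probFilter μ)
          (nhds 0) := by
        simpa using hsub.norm.mul_const ‖t‖
      refine squeeze_zero_norm (fun s => ?_) h0
      refine (norm_exp_mul_I_sub_exp_mul_I_le _ _).trans ?_
      rw [← inner_sub_left]
      exact abs_real_inner_le_norm _ _
  have hadd := (h t).add hdiff
  rw [add_zero] at hadd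
  refine hadd.congr fun n => ?_
  rw [integral_sub (hint W' hW' n) (hint W hW n)]
  ring

lemma tendsto_integral_exp_of_gaussian {Z : (n : ℕ) → Ω n → ℝ}
    (h : TendstoInDistribution Z atTop id μ (gaussianReal 0 1)) (t : ℝ) :
    Tendsto (fun n => ∫ ω, Complex.exp ((t * Z n ω : ℝ) * Complex.I) ∂(μ n)) atTop
      (nhds (Complex.exp (-t ^ 2 / 2))) := by
  have := (ProbabilityMeasure.tendsto_iff_tendsto_charFun.1 h.tendsto) t
  simp only [ProbabilityMeasure.coe_mk, Measure.map_id, charFun_gaussianReal] at this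
  refine Tendsto.congr (fun n => ?_) (this.trans (le_of_eq ?_))
  · rw [charFun_apply_real, integral_map (h.forall_aemeasurable n)
      (Measurable.aestronglyMeasurable (by fun_prop))]
    simp
  · congr 2
    simp [neg_div]

end Prob

/-! ### Matrix-vector algebra and the sketched Gram matrix -/

section MatVec

variable {k l p n m : ℕ}

@[simp] lemma ofLp_mv (A : Matrix (Fin k) (Fin l) ℝ) (v : Vec l) :
    (mv A v).ofLp = A *ᵥ v.ofLp := rfl

lemma mv_mul (A : Matrix (Fin k) (Fin l) ℝ) (B : Matrix (Fin l) (Fin p) ℝ) (v : Vec p) :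
    mv (A * B) v = mv A (mv B v) := by
  simp [mv, Matrix.mulVec_mulVec]

lemma mv_add (A : Matrix (Fin k) (Fin l) ℝ) (v w : Vec l) : mv A (v + w) = mv A v + mv A w := by
  simp [mv, Matrix.mulVec_add]

lemma mv_sub (A : Matrix (Fin k) (Fin l) ℝ) (v w : Vec l) : mv A (v - w) = mv A v - mv A w := by
  simp [mv, Matrix.mulVec_sub]

lemma mv_smul (A : Matrix (Fin k) (Fin l) ℝ) (c : ℝ) (v : Vec l) :
    mv A (c • v) = c • mv A v := by
  simp [mv, Matrix.mulVec_smul]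

lemma sub_mv (A B : Matrix (Fin k) (Fin l) ℝ) (v : Vec l) : mv (A - B) v = mv A v - mv B v := by
  simp [mv, Matrix.sub_mulVec]

lemma smul_mv (A : Matrix (Fin k) (Fin l) ℝ) (c : ℝ) (v : Vec l) :
    mv (c • A) v = c • mv A v := by
  simp [mv, Matrix.smul_mulVec]

@[simp] lemma one_mv (v : Vec k) : mv 1 v = v := by
  simp [mv]

lemma inner_eq_dotProduct (v w : Vec k) : inner ℝ v w = v.ofLp ⬝ᵥ w.ofLp := by
  simp [EuclideanSpace.inner_eq_star_dotProduct, dotProduct_comm]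

lemma norm_sq_eq_dotProduct (v : Vec k) : ‖v‖ ^ 2 = v.ofLp ⬝ᵥ v.ofLp := by
  rw [← inner_eq_dotProduct, real_inner_self_eq_norm_sq]

lemma mulVec_dotProduct (A : Matrix (Fin k) (Fin l) ℝ) (v : Fin l → ℝ) (w : Fin k → ℝ) :
    (A *ᵥ v) ⬝ᵥ w = v ⬝ᵥ (Aᵀ *ᵥ w) := by
  rw [Matrix.mulVec_transpose, dotProduct_comm, Matrix.dotProduct_mulVec, dotProduct_comm]

lemma norm_mv_of_transpose_mul_self {U : Matrix (Fin n) (Fin p) ℝ} (hU : Uᵀ * U = 1) (v : Vec p) :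
    ‖mv U v‖ = ‖v‖ := by
  rw [← sq_eq_sq₀ (norm_nonneg _) (norm_nonneg _), norm_sq_eq_dotProduct, norm_sq_eq_dotProduct,
    ofLp_mv, mulVec_dotProduct, Matrix.mulVec_mulVec, hU, Matrix.one_mulVec]

lemma norm_normalized {v : Vec k} (hv : v ≠ 0) : ‖normalized v‖ = 1 := by
  rw [normalized, norm_smul, norm_inv, norm_norm, inv_mul_cancel₀ (norm_ne_zero_iff.2 hv)]

lemma norm_smul_normalized (v : Vec k) : ‖v‖ • normalized v = v := by
  by_cases hv : v = 0
  · simp [hv]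
  · rw [normalized, smul_smul, mul_inv_cancel₀ (norm_ne_zero_iff.2 hv), one_smul]

/-- The sketched Gram matrix in an orthonormal basis, `Uᵀ Sᵀ S U`. -/
def sketchGram (S : Matrix (Fin m) (Fin n) ℝ) (U : Matrix (Fin n) (Fin p) ℝ) :
    Matrix (Fin p) (Fin p) ℝ :=
  (S * U)ᵀ * (S * U)

/-- The vector `Uᵀ (Sᵀ S e - e)`. -/
def sketchDev (S : Matrix (Fin m) (Fin n) ℝ) (U : Matrix (Fin n) (Fin p) ℝ) (e : Vec n) : Vec p :=
  mv Uᵀ (mv (Sᵀ * S) e - e)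

lemma dotProduct_sketchDev (S : Matrix (Fin m) (Fin n) ℝ) (U : Matrix (Fin n) (Fin p) ℝ)
    (e : Vec n) (b : Vec p) :
    b.ofLp ⬝ᵥ (sketchDev S U e).ofLp = quadDev S (mv U b) e := by
  unfold quadDev sketchDev
  rw [ofLp_mv, ofLp_mv, ← mulVec_dotProduct, WithLp.ofLp_sub, ofLp_mv, dotProduct_sub]

lemma dotProduct_sketchGram (S : Matrix (Fin m) (Fin n) ℝ) {U : Matrix (Fin n) (Fin p) ℝ}
    (hU : Uᵀ * U = 1) (b : Vec p) :
    b.ofLp ⬝ᵥ ((sketchGram S U - 1) *ᵥ b.ofLp) = quadDev S (mv U b) (mv U b) := by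
  unfold quadDev sketchGram
  rw [Matrix.sub_mulVec, dotProduct_sub, Matrix.one_mulVec]
  congr 1
  · rw [ofLp_mv, mulVec_dotProduct, Matrix.mulVec_mulVec, Matrix.mulVec_mulVec]
    simp only [Matrix.transpose_mul, Matrix.mul_assoc]
  · rw [← norm_sq_eq_dotProduct, ← norm_sq_eq_dotProduct, norm_mv_of_transpose_mul_self hU]

lemma sketchGram_transpose (S : Matrix (Fin m) (Fin n) ℝ) (U : Matrix (Fin n) (Fin p) ℝ) :
    (sketchGram S U)ᵀ = sketchGram S U := by
  simp [sketchGram, Matrix.mul_assoc]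

lemma inv_smul_eq {k : ℝ} (hk : k ≠ 0) (A : Matrix (Fin p) (Fin p) ℝ) :
    (k • A)⁻¹ = k⁻¹ • A⁻¹ := by
  by_cases hA : IsUnit A.det
  · exact Matrix.inv_smul' A (Units.mk0 k hk) hA
  · have h2 : ¬ IsUnit (k • A).det := by
      simp only [Matrix.det_smul, isUnit_iff_ne_zero, not_not] at hA ⊢
      rw [hA, mul_zero]
    rw [Matrix.nonsing_inv_apply_not_isUnit _ hA, Matrix.nonsing_inv_apply_not_isUnit _ h2,
      smul_zero]

lemma inv_matSqrt_sq_smul {N : Matrix (Fin p) (Fin p) ℝ} (hN : N.PosSemidef)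
    (T : Matrix (Fin p) (Fin p) ℝ) {k : ℝ} (hk : 0 < k) :
    (matSqrt (k ^ 2 • (T * N * Tᵀ)))⁻¹ = k⁻¹ • (symSqrt (T * N * Tᵀ))⁻¹ := by
  have h := posSemidef_conj hN T
  rw [matSqrt_sq_smul h hk.le, inv_smul_eq hk.ne',
    symSqrt_eq_matSqrt (transpose_eq_of_isHermitian h.1)]

end MatVec

/-! ### Exact formulas for the estimators in orthonormal coordinates -/

/-- A factorization `X T = θ U` of a full rank matrix, with `U` orthonormal and `T` invertible. -/
structure IsOrthFactor {n p : ℕ} (X U : Matrix (Fin n) (Fin p) ℝ) (T : Matrix (Fin p) (Fin p) ℝ)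
    (θ : ℝ) : Prop where
  orthU : Uᵀ * U = 1
  det_ne : T.det ≠ 0
  ne_zero : θ ≠ 0
  eq : X * T = θ • U

namespace IsOrthFactor

variable {n p m : ℕ} {X U : Matrix (Fin n) (Fin p) ℝ} {T : Matrix (Fin p) (Fin p) ℝ} {θ : ℝ}

lemma mul_inv (h : IsOrthFactor X U T θ) : T * T⁻¹ = 1 :=
  Matrix.mul_nonsing_inv _ (isUnit_iff_ne_zero.2 h.det_ne)

lemma eq_mul (h : IsOrthFactor X U T θ) : X = θ • (U * T⁻¹) := by
  rw [← Matrix.smul_mul, ← h.eq, Matrix.mul_assoc, h.mul_inv, Matrix.mul_one]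

lemma inv_gram (h : IsOrthFactor X U T θ) (S : Matrix (Fin m) (Fin n) ℝ) :
    ((S * X)ᵀ * (S * X))⁻¹ = θ⁻¹ ^ 2 • (T * (sketchGram S U)⁻¹ * Tᵀ) := by
  have h1 : (S * X)ᵀ * (S * X) = θ ^ 2 • ((T⁻¹)ᵀ * sketchGram S U * T⁻¹) := by
    rw [h.eq_mul]
    simp only [sketchGram, Matrix.transpose_mul, Matrix.transpose_smul, Matrix.mul_smul,
      Matrix.smul_mul, smul_smul, Matrix.mul_assoc, sq]
  have hT : IsUnit T.det := isUnit_iff_ne_zero.2 h.det_ne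
  rw [h1, inv_smul_eq (pow_ne_zero 2 h.ne_zero), Matrix.mul_inv_rev, Matrix.mul_inv_rev,
    Matrix.nonsing_inv_nonsing_inv _ hT, ← Matrix.transpose_nonsing_inv,
    Matrix.nonsing_inv_nonsing_inv _ hT, inv_pow, Matrix.mul_assoc]

lemma inv_gram_mul_transpose (h : IsOrthFactor X U T θ) (S : Matrix (Fin m) (Fin n) ℝ) :
    ((S * X)ᵀ * (S * X))⁻¹ * Xᵀ = θ⁻¹ • (T * (sketchGram S U)⁻¹ * Uᵀ) := by
  have h2 : Tᵀ * Xᵀ = θ • Uᵀ := by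
    rw [← Matrix.transpose_mul, h.eq, Matrix.transpose_smul]
  rw [h.inv_gram, Matrix.smul_mul, Matrix.mul_assoc, h2, Matrix.mul_smul, smul_smul]
  congr 1
  field_simp [h.ne_zero]

lemma sketchGram_one (h : IsOrthFactor X U T θ) :
    sketchGram (1 : Matrix (Fin n) (Fin n) ℝ) U = 1 := by
  simp [sketchGram, h.orthU]

lemma lsCoef_eq (h : IsOrthFactor X U T θ) (y : Vec n) :
    lsCoef X y = θ⁻¹ • mv T (mv Uᵀ y) := by
  -- Unsketched least squares is the case `S = 1`.
  have := h.inv_gram_mul_transpose (1 : Matrix (Fin n) (Fin n) ℝ)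
  simp only [Matrix.one_mul, h.sketchGram_one, inv_one, Matrix.mul_one] at this
  rw [lsCoef, this, smul_mv, mv_mul]

lemma fitted_eq (h : IsOrthFactor X U T θ) (y : Vec n) : fitted X y = mv U (mv Uᵀ y) := by
  rw [fitted, h.lsCoef_eq, mv_smul, ← mv_mul, h.eq, smul_mv, smul_smul,
    inv_mul_cancel₀ h.ne_zero, one_smul]

lemma mv_transpose_residual (h : IsOrthFactor X U T θ) (y : Vec n) :
    mv Uᵀ (residual X y) = 0 := by
  have := h.fitted_eq y
  unfold fitted at this
  rw [residual, this, mv_sub, ← mv_mul Uᵀ U, h.orthU, one_mv, sub_self]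

lemma partialSketch_eq (h : IsOrthFactor X U T θ) (S : Matrix (Fin m) (Fin n) ℝ) (y : Vec n) :
    partialSketch S X y = θ⁻¹ • mv T (mv (sketchGram S U)⁻¹ (mv Uᵀ y)) := by
  rw [partialSketch, h.inv_gram_mul_transpose, smul_mv, mv_mul, mv_mul]

lemma sketchSolve_eq (h : IsOrthFactor X U T θ) (S : Matrix (Fin m) (Fin n) ℝ) (y : Vec n) :
    sketchSolve S X y =
      θ⁻¹ • mv T (mv (sketchGram S U)⁻¹ (mv Uᵀ (mv (Sᵀ * S) y))) := by
  have h1 : ((S * X)ᵀ * (S * X))⁻¹ * (S * X)ᵀ = ((S * X)ᵀ * (S * X))⁻¹ * Xᵀ * Sᵀ := by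
    rw [Matrix.mul_assoc, ← Matrix.transpose_mul]
  rw [sketchSolve, lsCoef, h1, h.inv_gram_mul_transpose]
  simp only [Matrix.smul_mul, smul_mv, mv_mul]

lemma sketchDev_residual (h : IsOrthFactor X U T θ) (S : Matrix (Fin m) (Fin n) ℝ) (y : Vec n) :
    sketchDev S U (normalized (residual X y)) =
      mv Uᵀ (mv (Sᵀ * S) (normalized (residual X y))) := by
  rw [sketchDev, mv_sub]
  conv_lhs => arg 2; rw [normalized, mv_smul, h.mv_transpose_residual, smul_zero]
  rw [sub_zero]

/-- Split `y` into `U Uᵀ y` and the residual. The first part is recovered without error because `G⁻¹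
Uᵀ Sᵀ S U = 1`; for the second, `Uᵀ` annihilates the residual, so no centring term appears. -/
lemma sketchSolve_sub_lsCoef (h : IsOrthFactor X U T θ) {S : Matrix (Fin m) (Fin n) ℝ}
    (hG : (sketchGram S U).det ≠ 0) (y : Vec n) :
    sketchSolve S X y - lsCoef X y = (θ⁻¹ * ‖residual X y‖) •
      mv T (mv (sketchGram S U)⁻¹ (sketchDev S U (normalized (residual X y)))) := by
  have hy : y = mv U (mv Uᵀ y) + ‖residual X y‖ • normalized (residual X y) := by
    have := h.fitted_eq y
    unfold fitted at this
    rw [norm_smul_normalized, residual, this]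
    abel
  have hGi : (sketchGram S U)⁻¹ * sketchGram S U = 1 :=
    Matrix.nonsing_inv_mul _ (isUnit_iff_ne_zero.2 hG)
  rw [h.sketchSolve_eq, h.lsCoef_eq, h.sketchDev_residual]
  nth_rewrite 1 [hy]
  have h3 : mv Uᵀ (mv (Sᵀ * S) (mv U (mv Uᵀ y))) = mv (sketchGram S U) (mv Uᵀ y) := by
    simp only [← mv_mul, sketchGram, Matrix.transpose_mul, Matrix.mul_assoc]
  simp only [mv_add, mv_smul, smul_add]
  rw [h3, ← mv_mul (sketchGram S U)⁻¹, hGi, one_mv, add_sub_cancel_left, smul_smul]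

/-- With `v = Uᵀ y`, the error comes from `G⁻¹ v - v = -G⁻¹ (G v - v)`, and `G v - v` is the
deviation along the fit. This is the origin of the minus sign. -/
lemma partialSketch_sub_lsCoef (h : IsOrthFactor X U T θ) {S : Matrix (Fin m) (Fin n) ℝ}
    (hG : (sketchGram S U).det ≠ 0) (y : Vec n) :
    partialSketch S X y - lsCoef X y = -((θ⁻¹ * ‖fitted X y‖) •
      mv T (mv (sketchGram S U)⁻¹ (sketchDev S U (normalized (fitted X y))))) := by
  have hGi : (sketchGram S U)⁻¹ * sketchGram S U = 1 :=
    Matrix.nonsing_inv_mul _ (isUnit_iff_ne_zero.2 hG)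
  have h3 : ‖fitted X y‖ • sketchDev S U (normalized (fitted X y)) =
      mv (sketchGram S U) (mv Uᵀ y) - mv Uᵀ y := by
    rw [sketchDev, ← mv_smul, smul_sub, ← mv_smul, norm_smul_normalized, mv_sub, h.fitted_eq]
    congr 1
    · simp only [← mv_mul, sketchGram, Matrix.transpose_mul, Matrix.mul_assoc]
    · rw [← mv_mul, h.orthU, one_mv]
  rw [h.partialSketch_eq, h.lsCoef_eq, mul_smul, ← mv_smul T ‖fitted X y‖,
    ← mv_smul (sketchGram S U)⁻¹ ‖fitted X y‖, h3,
    mv_sub (sketchGram S U)⁻¹, ← mv_mul (sketchGram S U)⁻¹ (sketchGram S U), hGi, one_mv,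
    mv_sub T, smul_sub,
    neg_sub]

/-- The squared norm of the sketched residual relative to that of the residual. -/
lemma norm_sketched_residual_sq (h : IsOrthFactor X U T θ) {S : Matrix (Fin m) (Fin n) ℝ}
    (hG : (sketchGram S U).det ≠ 0) {y : Vec n} (hy : residual X y ≠ 0) :
    (‖mv S y - mv (S * X) (sketchSolve S X y)‖ / ‖residual X y‖) ^ 2 =
      1 + quadDev S (normalized (residual X y)) (normalized (residual X y)) -
        2 * ((mv (sketchGram S U)⁻¹ (sketchDev S U (normalized (residual X y)))).ofLp ⬝ᵥ
          (sketchDev S U (normalized (residual X y))).ofLp) +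
        (mv (sketchGram S U)⁻¹ (sketchDev S U (normalized (residual X y)))).ofLp ⬝ᵥ
          (sketchGram S U *ᵥ
            (mv (sketchGram S U)⁻¹ (sketchDev S U (normalized (residual X y)))).ofLp) := by
  set e := normalized (residual X y) with he
  set w := mv (sketchGram S U)⁻¹ (sketchDev S U e) with hw
  have hne : ‖residual X y‖ ≠ 0 := norm_ne_zero_iff.2 hy
  have hdiff := h.sketchSolve_sub_lsCoef hG y
  rw [← he, ← hw] at hdiff
  -- The sketched residual is `‖ε‖ (S e - S U w)`; the claim is the expansion of its squared norm.
  have h1 : mv S y - mv (S * X) (sketchSolve S X y) =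
      ‖residual X y‖ • (mv S e - mv (S * U) w) := by
    have h2 : mv (S * X) (mv T w) = θ • mv (S * U) w := by
      rw [← mv_mul, Matrix.mul_assoc, h.eq, Matrix.mul_smul, smul_mv]
    have h3 : mv S y - mv (S * X) (lsCoef X y) = ‖residual X y‖ • mv S e := by
      rw [← mv_smul, he, norm_smul_normalized, residual, mv_sub, mv_mul]
    rw [sub_eq_iff_eq_add.1 hdiff, mv_add, mv_smul, h2, smul_smul, mul_right_comm,
      inv_mul_cancel₀ h.ne_zero, one_mul, smul_sub, ← h3]
    abel
  have hee : e.ofLp ⬝ᵥ e.ofLp = 1 := by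
    rw [← norm_sq_eq_dotProduct, norm_normalized hy, one_pow]
  have hq : quadDev S e e = (S *ᵥ e.ofLp) ⬝ᵥ (S *ᵥ e.ofLp) - 1 := by
    rw [quadDev, hee, mulVec_dotProduct, Matrix.mulVec_mulVec]
  have hdev : (sketchDev S U e).ofLp = (S * U)ᵀ *ᵥ (S *ᵥ e.ofLp) := by
    rw [h.sketchDev_residual, ← he]
    simp only [ofLp_mv, Matrix.mulVec_mulVec, Matrix.transpose_mul, Matrix.mul_assoc]
  rw [h1, norm_smul, norm_norm, mul_div_cancel_left₀ _ hne, norm_sq_eq_dotProduct, hq, hdev,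
    sketchGram, ← Matrix.mulVec_mulVec, ← mulVec_dotProduct, ← mulVec_dotProduct, WithLp.ofLp_sub,
    ofLp_mv, ofLp_mv, sub_dotProduct, dotProduct_sub, dotProduct_sub,
    dotProduct_comm (S *ᵥ e.ofLp) ((S * U) *ᵥ w.ofLp)]
  ring

end IsOrthFactor

/-- `X V = U L`, so `T = θ V L⁻¹` works for every `θ ≠ 0`. The size of `θ` is later used to keep `T`
bounded, and its sign to absorb the minus sign of partial sketching. -/
lemma IsSVD.isOrthFactor {n p : ℕ} {X U : Matrix (Fin n) (Fin p) ℝ} {ℓ : Fin p → ℝ}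
    {V : Matrix (Fin p) (Fin p) ℝ} (h : IsSVD X U ℓ V) {θ : ℝ} (hθ : θ ≠ 0) :
    IsOrthFactor X U (V * diagonal fun i => θ / ℓ i) θ where
  orthU := h.orthU
  det_ne := by
    have h1 : V.det ≠ 0 := fun h0 => by
      have := congrArg Matrix.det h.orthV
      simp [h0] at this
    rw [Matrix.det_mul, Matrix.det_diagonal]
    exact mul_ne_zero h1 (Finset.prod_ne_zero_iff.2 fun i _ => div_ne_zero hθ (h.pos i).ne')
  ne_zero := hθ
  eq := by
    rw [h.eq, Matrix.mul_assoc, ← Matrix.mul_assoc Vᵀ, h.orthV, Matrix.one_mul, Matrix.mul_assoc,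
      Matrix.diagonal_mul_diagonal]
    have : (fun i => ℓ i * (θ / ℓ i)) = fun _ => θ := by
      funext i
      field_simp [(h.pos i).ne']
    rw [this]
    ext i j
    simp [Matrix.mul_diagonal, mul_comm]

lemma limitCov_eq {p : ℕ} (V : Matrix (Fin p) (Fin p) ℝ) {ℓ : Fin p → ℝ} (hℓ : ∀ i, 0 < ℓ i)
    (M : Matrix (Fin p) (Fin p) ℝ) {θ : ℝ} (hθ : θ ≠ 0) :
    limitCov V ℓ M = θ⁻¹ ^ 2 • ((V * diagonal fun i => θ / ℓ i) * M *
      (V * diagonal fun i => θ / ℓ i)ᵀ) := by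
  have hinv : (diagonal ℓ)⁻¹ = θ⁻¹ • diagonal fun i => θ / ℓ i := by
    refine Matrix.inv_eq_right_inv ?_
    rw [Matrix.mul_smul, Matrix.diagonal_mul_diagonal, ← Matrix.diagonal_smul,
      ← Matrix.diagonal_one]
    congr 1
    funext i
    have := (hℓ i).ne'
    simp only [Pi.smul_apply, smul_eq_mul]
    field_simp
  simp only [limitCov, hinv, Matrix.transpose_mul, Matrix.diagonal_transpose, Matrix.mul_smul,
    Matrix.smul_mul, smul_smul, Matrix.mul_assoc, sq]

lemma abs_apply_le_one_of_transpose_mul_self {p : ℕ} {V : Matrix (Fin p) (Fin p) ℝ}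
    (hV : Vᵀ * V = 1) (i j : Fin p) : |V i j| ≤ 1 := by
  have h := congrFun (congrFun hV j) j
  rw [Matrix.mul_apply, Matrix.one_apply_eq] at h
  have h2 : V i j * V i j ≤ 1 := by
    rw [← h]
    exact Finset.single_le_sum (f := fun k => Vᵀ j k * V k j)
      (fun k _ => mul_self_nonneg (V k j)) (Finset.mem_univ i)
  exact abs_le_one_iff_mul_self_le_one.2 h2

lemma abs_det_eq_one_of_transpose_mul_self {p : ℕ} {V : Matrix (Fin p) (Fin p) ℝ}
    (hV : Vᵀ * V = 1) : |V.det| = 1 := by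
  have := congrArg Matrix.det hV
  rw [Matrix.det_mul, Matrix.det_transpose, Matrix.det_one] at this
  have h2 : |V.det| * |V.det| = 1 := by rw [abs_mul_abs_self, this]
  nlinarith [abs_nonneg V.det]

lemma continuous_mv {k l : ℕ} :
    Continuous fun x : Matrix (Fin k) (Fin l) ℝ × Vec l => mv x.1 x.2 :=
  (PiLp.continuous_toLp 2 _).comp
    (continuous_fst.matrix_mulVec ((PiLp.continuous_ofLp 2 _).comp continuous_snd))

lemma continuous_outer {p : ℕ} : Continuous fun x : Vec p => outer x :=
  (PiLp.continuous_ofLp 2 _).matrix_vecMulVec (PiLp.continuous_ofLp 2 _)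

/-! ### Measurability of the statistics -/

section Measurability

variable {k l p n m : ℕ}

/-- The product σ-algebra on matrices. -/
@[reducible] def matrixMeasurableSpace (k l : ℕ) : MeasurableSpace (Matrix (Fin k) (Fin l) ℝ) :=
  inferInstanceAs (MeasurableSpace (Fin k → Fin l → ℝ))

attribute [local instance] matrixMeasurableSpace

lemma matrix_borelSpace (k l : ℕ) : BorelSpace (Matrix (Fin k) (Fin l) ℝ) :=
  inferInstanceAs (BorelSpace (Fin k → Fin l → ℝ))

lemma matrix_secondCountableTopology (k l : ℕ) :
    SecondCountableTopology (Matrix (Fin k) (Fin l) ℝ) :=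
  inferInstanceAs (SecondCountableTopology (Fin k → Fin l → ℝ))

attribute [local instance] matrix_borelSpace matrix_secondCountableTopology

variable {Ω : Type*} [MeasurableSpace Ω]

lemma measurable_matrix {A : Ω → Matrix (Fin k) (Fin l) ℝ}
    (h : ∀ i j, Measurable fun ω => A ω i j) :
    Measurable A :=
  measurable_pi_lambda _ fun i => measurable_pi_lambda _ fun j => h i j

lemma measurable_matrix_mul {A : Ω → Matrix (Fin k) (Fin l) ℝ} {B : Ω → Matrix (Fin l) (Fin p) ℝ}
    (hA : Measurable A) (hB : Measurable B) : Measurable fun ω => A ω * B ω := by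
  have h : Continuous fun x : Matrix (Fin k) (Fin l) ℝ × Matrix (Fin l) (Fin p) ℝ =>
    x.1 * x.2 := continuous_fst.matrix_mul continuous_snd
  exact h.measurable.comp (hA.prodMk hB)

lemma measurable_matrix_transpose {A : Ω → Matrix (Fin k) (Fin l) ℝ} (hA : Measurable A) :
    Measurable fun ω => (A ω)ᵀ := by
  have h : Continuous fun x : Matrix (Fin k) (Fin l) ℝ => xᵀ := continuous_id.matrix_transpose
  exact h.measurable.comp hA

lemma measurable_matrix_smul {c : Ω → ℝ} {A : Ω → Matrix (Fin k) (Fin l) ℝ} (hc : Measurable c)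
    (hA : Measurable A) : Measurable fun ω => c ω • A ω := by
  have h : Continuous fun x : ℝ × Matrix (Fin k) (Fin l) ℝ => x.1 • x.2 :=
    continuous_fst.smul continuous_snd
  exact h.measurable.comp (hc.prodMk hA)

lemma measurable_matrix_add {A B : Ω → Matrix (Fin k) (Fin l) ℝ} (hA : Measurable A)
    (hB : Measurable B) : Measurable fun ω => A ω + B ω := by
  have h : Continuous fun x : Matrix (Fin k) (Fin l) ℝ × Matrix (Fin k) (Fin l) ℝ =>
    x.1 + x.2 := continuous_fst.add continuous_snd
  exact h.measurable.comp (hA.prodMk hB)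

lemma measurable_matrix_inv {A : Ω → Matrix (Fin k) (Fin k) ℝ} (hA : Measurable A) :
    Measurable fun ω => (A ω)⁻¹ := by
  have hd : Continuous fun x : Matrix (Fin k) (Fin k) ℝ => x.det := continuous_id.matrix_det
  have ha : Continuous fun x : Matrix (Fin k) (Fin k) ℝ => x.adjugate :=
    continuous_id.matrix_adjugate
  simp only [Matrix.inv_def, Ring.inverse_eq_inv']
  exact measurable_matrix_smul (hd.measurable.comp hA).inv (ha.measurable.comp hA)

lemma measurable_mv {A : Ω → Matrix (Fin k) (Fin l) ℝ} {v : Ω → Vec l} (hA : Measurable A)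
    (hv : Measurable v) : Measurable fun ω => mv (A ω) (v ω) := by
  exact continuous_mv.measurable.comp (hA.prodMk hv)

lemma measurable_outer {v : Ω → Vec l} (hv : Measurable v) : Measurable fun ω => outer (v ω) := by
  exact continuous_outer.measurable.comp hv

lemma measurable_matSqrt {A : Ω → Matrix (Fin k) (Fin k) ℝ} (hA : Measurable A)
    (hpsd : ∀ ω, (A ω).PosSemidef) : Measurable fun ω => matSqrt (A ω) := by
  have h : (fun ω => matSqrt (A ω)) = symSqrt ∘ A := by
    funext ω
    rw [Function.comp_apply, symSqrt_eq_matSqrt (transpose_eq_of_isHermitian (hpsd ω).1)]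
  rw [h]
  exact continuous_symSqrt.measurable.comp hA

lemma posSemidef_gram (A : Matrix (Fin k) (Fin l) ℝ) : (Aᵀ * A).PosSemidef := by
  simpa using Matrix.posSemidef_conjTranspose_mul_self A

lemma posSemidef_sketchGram (S : Matrix (Fin m) (Fin n) ℝ) (U : Matrix (Fin n) (Fin p) ℝ) :
    (sketchGram S U).PosSemidef :=
  posSemidef_gram (S * U)

lemma posSemidef_outer (v : Vec k) : (outer v).PosSemidef := by
  simpa [outer] using Matrix.posSemidef_vecMulVec_self_star v.ofLp

lemma measurable_sketched {S : Ω → Matrix (Fin m) (Fin n) ℝ}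
    (hS : ∀ i j, Measurable fun ω => S ω i j) (X : Matrix (Fin n) (Fin p) ℝ) :
    Measurable fun ω => S ω * X :=
  measurable_matrix_mul (measurable_matrix hS) measurable_const

lemma measurable_sketched_gram {S : Ω → Matrix (Fin m) (Fin n) ℝ}
    (hS : ∀ i j, Measurable fun ω => S ω i j) (X : Matrix (Fin n) (Fin p) ℝ) :
    Measurable fun ω => (S ω * X)ᵀ * (S ω * X) :=
  measurable_matrix_mul (measurable_matrix_transpose (measurable_sketched hS X))
    (measurable_sketched hS X)

lemma measurable_sketchSolve {S : Ω → Matrix (Fin m) (Fin n) ℝ}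
    (hS : ∀ i j, Measurable fun ω => S ω i j) (X : Matrix (Fin n) (Fin p) ℝ) (y : Vec n) :
    Measurable fun ω => sketchSolve (S ω) X y :=
  measurable_mv (measurable_matrix_mul (measurable_matrix_inv (measurable_sketched_gram hS X))
    (measurable_matrix_transpose (measurable_sketched hS X)))
    (measurable_mv (measurable_matrix hS) measurable_const)

lemma measurable_partialSketch {S : Ω → Matrix (Fin m) (Fin n) ℝ}
    (hS : ∀ i j, Measurable fun ω => S ω i j) (X : Matrix (Fin n) (Fin p) ℝ) (y : Vec n) :
    Measurable fun ω => partialSketch (S ω) X y :=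
  measurable_mv (measurable_matrix_mul (measurable_matrix_inv (measurable_sketched_gram hS X))
    measurable_const) measurable_const

lemma measurable_sketchDev {S : Ω → Matrix (Fin m) (Fin n) ℝ}
    (hS : ∀ i j, Measurable fun ω => S ω i j) (U : Matrix (Fin n) (Fin p) ℝ) (e : Vec n) :
    Measurable fun ω => sketchDev (S ω) U e :=
  measurable_mv measurable_const ((measurable_mv (measurable_matrix_mul
    (measurable_matrix_transpose (measurable_matrix hS)) (measurable_matrix hS))
    measurable_const).sub_const e)

lemma measurable_const_mv {v : Ω → Vec l} (hv : Measurable v) (A : Matrix (Fin k) (Fin l) ℝ) :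
    Measurable fun ω => mv A (v ω) :=
  measurable_mv measurable_const hv

lemma measurable_smul_mv_smul_sub {v : Ω → Vec l} (hv : Measurable v) (r c : ℝ)
    (A : Matrix (Fin k) (Fin l) ℝ) (u : Vec l) :
    Measurable fun ω => r • mv A (c • (v ω - u)) := by
  have h : Measurable fun ω => c • (v ω - u) := (hv.sub_const u).const_smul c
  exact (measurable_const_mv h A).const_smul r

lemma measurable_studentized_sketchSolve {S : Ω → Matrix (Fin m) (Fin n) ℝ}
    (hS : ∀ i j, Measurable fun ω => S ω i j) (X : Matrix (Fin n) (Fin p) ℝ) (y : Vec n) (r : ℝ) :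
    Measurable fun ω => (r * ‖mv (S ω) y - mv (S ω * X) (sketchSolve (S ω) X y)‖⁻¹) •
      mv (matSqrt ((S ω * X)ᵀ * (S ω * X))) (sketchSolve (S ω) X y - lsCoef X y) := by
  have h1 := measurable_sketchSolve hS X y
  have h2 : Measurable fun ω => mv (S ω) y - mv (S ω * X) (sketchSolve (S ω) X y) :=
    (measurable_mv (measurable_matrix hS) measurable_const).sub
      (measurable_mv (measurable_sketched hS X) h1)
  exact (h2.norm.inv.const_mul r).smul (measurable_mv
    (measurable_matSqrt (measurable_sketched_gram hS X) fun ω => posSemidef_gram _)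
    (h1.sub_const _))

lemma posSemidef_partialSketch_cov (S : Matrix (Fin m) (Fin n) ℝ) (X : Matrix (Fin n) (Fin p) ℝ)
    (c : ℝ) {a : ℝ} (ha : 0 ≤ a) (v : Vec p) :
    (c ^ 2 • ((S * X)ᵀ * (S * X))⁻¹ + a • outer v).PosSemidef :=
  ((posSemidef_gram (S * X)).inv.smul (sq_nonneg c)).add ((posSemidef_outer v).smul ha)

lemma measurable_studentized_partialSketch {S : Ω → Matrix (Fin m) (Fin n) ℝ}
    (hS : ∀ i j, Measurable fun ω => S ω i j) (X : Matrix (Fin n) (Fin p) ℝ) (y : Vec n) (r : ℝ)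
    {a : ℝ} (ha : 0 ≤ a) :
    Measurable fun ω => r • mv (matSqrt (‖mv (S ω * X) (partialSketch (S ω) X y)‖ ^ 2 •
        ((S ω * X)ᵀ * (S ω * X))⁻¹ + a • outer (partialSketch (S ω) X y)))⁻¹
      (partialSketch (S ω) X y - lsCoef X y) := by
  have h1 := measurable_partialSketch hS X y
  have h2 := (measurable_mv (measurable_sketched hS X) h1).norm.pow_const 2
  refine (measurable_mv (measurable_matrix_inv (measurable_matSqrt (measurable_matrix_add
    (measurable_matrix_smul h2 (measurable_matrix_inv (measurable_sketched_gram hS X)))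
    (measurable_matrix_smul measurable_const (measurable_outer h1))) fun ω => ?_))
    (h1.sub_const _)).const_smul r
  exact posSemidef_partialSketch_cov _ _ _ ha _

end Measurability

/-! ### From quadratic forms to matrices -/

section QuadraticForms

variable {p : ℕ}

lemma exists_unit_vec (hp : 0 < p) : ∃ v : Vec p, ‖v‖ = 1 :=
  ⟨EuclideanSpace.single ⟨0, hp⟩ 1, by simp⟩

/-- If the quadratic forms of `M n` are bounded away from zero and infinity along every sequence of
unit vectors, then they are so uniformly. -/
lemma exists_uniform_bounds (hp : 0 < p) {n₀ : ℕ} {M : ℕ → Matrix (Fin p) (Fin p) ℝ}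
    (hM : ∀ n ≥ n₀, (M n)ᵀ = M n)
    (h : ∀ b : ℕ → Vec p, (∀ n, ‖b n‖ = 1) → ∃ c C : ℝ, 0 < c ∧ ∀ n ≥ n₀,
      c ≤ (b n).ofLp ⬝ᵥ (M n *ᵥ (b n).ofLp) ∧ (b n).ofLp ⬝ᵥ (M n *ᵥ (b n).ofLp) ≤ C) :
    ∃ c C : ℝ, 0 < c ∧ ∀ n ≥ n₀, (∀ v : Fin p → ℝ, c * (v ⬝ᵥ v) ≤ v ⬝ᵥ (M n *ᵥ v)) ∧
      ∀ i j, |M n i j| ≤ C := by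
  obtain ⟨u, hu⟩ := exists_unit_vec hp
  have hne : (Metric.sphere (0 : Vec p) 1).Nonempty := ⟨u, by simpa using hu⟩
  have hcont : ∀ n, Continuous fun b : Vec p => b.ofLp ⬝ᵥ (M n *ᵥ b.ofLp) := fun n =>
    (PiLp.continuous_ofLp 2 _).dotProduct
      (continuous_const.matrix_mulVec (PiLp.continuous_ofLp 2 _))
  -- The minimizers and the maximizers on the sphere are themselves sequences of unit vectors; the
  -- hypothesis along these two gives bounds uniform over all directions.
  have hmin := fun n => (isCompact_sphere (0 : Vec p) 1).exists_isMinOn hne (hcont n).continuousOn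
  have hmax := fun n => (isCompact_sphere (0 : Vec p) 1).exists_isMaxOn hne (hcont n).continuousOn
  choose b1 hb1 hb1' using hmin
  choose b2 hb2 hb2' using hmax
  obtain ⟨c, _, hc, h1⟩ := h b1 fun n => by simpa using hb1 n
  obtain ⟨_, C, _, h2⟩ := h b2 fun n => by simpa using hb2 n
  have hscale : ∀ n, ∀ v : Fin p → ℝ, v ≠ 0 → ∃ b ∈ Metric.sphere (0 : Vec p) 1,
      v ⬝ᵥ (M n *ᵥ v) = (v ⬝ᵥ v) * (b.ofLp ⬝ᵥ (M n *ᵥ b.ofLp)) := by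
    intro n v hv
    have hw : (WithLp.toLp 2 v : Vec p) ≠ 0 := by simpa using hv
    refine ⟨normalized (WithLp.toLp 2 v), by simpa using norm_normalized hw, ?_⟩
    have hs := norm_sq_eq_dotProduct (WithLp.toLp 2 v : Vec p)
    simp only at hs
    have hn := norm_ne_zero_iff.2 hw
    simp only [normalized, WithLp.ofLp_smul, Matrix.mulVec_smul, smul_dotProduct, dotProduct_smul,
      smul_eq_mul]
    rw [← hs]
    field_simp
  have hlow : ∀ n ≥ n₀, ∀ v : Fin p → ℝ, c * (v ⬝ᵥ v) ≤ v ⬝ᵥ (M n *ᵥ v) := by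
    intro n hn v
    by_cases hv : v = 0
    · simp [hv]
    · obtain ⟨b, hb, heq⟩ := hscale n v hv
      have h3 : 0 ≤ v ⬝ᵥ v := Finset.sum_nonneg fun i _ => mul_self_nonneg (v i)
      have h4 : c ≤ b.ofLp ⬝ᵥ (M n *ᵥ b.ofLp) := (h1 n hn).1.trans (hb1' n hb)
      rw [heq]
      nlinarith
  refine ⟨c, C, hc, fun n hn => ⟨hlow n hn, fun i j => ?_⟩⟩
  have hdiag : ∀ i, M n i i ≤ C := by
    intro i
    have hb : (EuclideanSpace.single i (1 : ℝ) : Vec p) ∈ Metric.sphere (0 : Vec p) 1 := by simp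
    have h3 : (EuclideanSpace.single i (1 : ℝ) : Vec p).ofLp ⬝ᵥ
        (M n *ᵥ (EuclideanSpace.single i (1 : ℝ) : Vec p).ofLp) ≤ C :=
      le_trans (hb2' n hb) (h2 n hn).2
    simpa [EuclideanSpace.single] using h3
  have hsym : M n j i = M n i j := by
    conv_lhs => rw [← hM n hn]
    rfl
  -- Nonnegativity at `e_i ± e_j` bounds the off-diagonal entries by the diagonal ones.
  have hpm : ∀ s : ℝ, 0 ≤ M n i i + s * M n i j + s * (M n j i + s * M n j j) := by
    intro s
    have h3 := hlow n hn (Pi.single i 1 + s • Pi.single j 1)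
    have h4 : 0 ≤ (Pi.single i 1 + s • Pi.single j 1 : Fin p → ℝ) ⬝ᵥ
        (Pi.single i 1 + s • Pi.single j 1) :=
      Finset.sum_nonneg fun k _ => mul_self_nonneg _
    have h5 := (mul_nonneg hc.le h4).trans h3
    simpa [Matrix.mulVec_add, Matrix.mulVec_smul, add_dotProduct, dotProduct_add, mul_add,
      add_assoc, add_left_comm, add_comm] using h5
  have h5 := hpm 1
  have h6 := hpm (-1)
  rw [hsym] at h5 h6
  rw [abs_le]
  constructor <;> linarith [hdiag i, hdiag j]

lemma tendsto_of_forall_quadratic_form {α : Type*} {l : Filter α}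
    {H : α → Matrix (Fin p) (Fin p) ℝ} (hH : ∀ s, (H s)ᵀ = H s)
    (h : ∀ b : Vec p, ‖b‖ = 1 → Tendsto (fun s => b.ofLp ⬝ᵥ (H s *ᵥ b.ofLp)) l (nhds 0)) :
    Tendsto H l (nhds 0) := by
  have hq : ∀ v : Fin p → ℝ, Tendsto (fun s => v ⬝ᵥ (H s *ᵥ v)) l (nhds 0) := by
    intro v
    by_cases hv : v = 0
    · simpa [hv] using tendsto_const_nhds
    · have hw : (WithLp.toLp 2 v : Vec p) ≠ 0 := by simpa using hv
      have hn := norm_ne_zero_iff.2 hw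
      have h1 := (h _ (norm_normalized hw)).const_mul (‖(WithLp.toLp 2 v : Vec p)‖ ^ 2)
      rw [mul_zero] at h1
      refine h1.congr fun s => ?_
      simp only [normalized, WithLp.ofLp_smul, Matrix.mulVec_smul, smul_dotProduct,
        dotProduct_smul, smul_eq_mul]
      field_simp
  refine tendsto_pi_nhds.2 fun i => tendsto_pi_nhds.2 fun j => ?_
  -- Polarization.
  have h2 := (((hq (Pi.single i 1 + Pi.single j 1)).sub (hq (Pi.single i 1))).sub
    (hq (Pi.single j 1))).div_const 2
  simp only [sub_zero, zero_div] at h2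
  refine h2.congr fun s => ?_
  have hsym : H s j i = H s i j := by
    conv_lhs => rw [← hH s]
    rfl
  simp only [Matrix.mulVec_add, add_dotProduct, dotProduct_add, Matrix.mulVec_single_one,
    single_one_dotProduct, Matrix.col_apply, hsym]
  ring

end QuadraticForms

/-! ### Cramér–Wold along moving directions -/

section Asymptotics

variable {Ω : ℕ → Type*} [∀ n, MeasurableSpace (Ω n)] {μ : (n : ℕ) → Measure (Ω n)}
  [∀ n, IsProbabilityMeasure (μ n)] {p : ℕ}

/-- A Cramér–Wold device for linear images of vectors with asymptotically normal projections. -/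
lemma tendstoStdNormal_mv (hp : 0 < p) {z : (n : ℕ) → Ω n → Vec p} (hz : ∀ n, Measurable (z n))
    {M A : ℕ → Matrix (Fin p) (Fin p) ℝ}
    (h : ∀ b : ℕ → Vec p, (∀ n, ‖b n‖ = 1) → ∃ s : ℕ → ℝ,
      (∀ᶠ n in atTop, s n = (b n).ofLp ⬝ᵥ (M n *ᵥ (b n).ofLp)) ∧
      TendstoInDistribution (fun n ω => (√(s n))⁻¹ * ((b n).ofLp ⬝ᵥ (z n ω).ofLp)) atTop id μ
        (gaussianReal 0 1))
    (hA : ∀ᶠ n in atTop, A n * M n * (A n)ᵀ = 1) :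
    TendstoStdNormal μ fun n ω => mv (A n) (z n ω) := by
  obtain ⟨u₀, hu₀⟩ := exists_unit_vec hp
  rw [tendstoStdNormal_iff fun n => (measurable_const_mv (hz n) (A n)).aemeasurable]
  intro t
  by_cases ht : t = 0
  · simp [ht]
  have htn := norm_pos_iff.2 ht
  set u : ℕ → Vec p := fun n => mv (A n)ᵀ t with hu
  -- The direction to test is that of `u = Aᵀ t`. The filler `u₀` serves only the indices with `u n
  -- = 0`, which eventually do not occur since `uᵀ M u = ‖t‖²`.
  set b : ℕ → Vec p := fun n => if u n = 0 then u₀ else normalized (u n) with hb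
  have hb1 : ∀ n, ‖b n‖ = 1 := by
    intro n
    by_cases h0 : u n = 0
    · simp [hb, h0, hu₀]
    · simp [hb, h0, norm_normalized h0]
  obtain ⟨s, hs, hlim⟩ := h b hb1
  have := tendsto_integral_exp_of_gaussian hlim ‖t‖
  refine this.congr' ?_
  filter_upwards [hs, hA] with n hsn hAn
  have hq : (u n).ofLp ⬝ᵥ (M n *ᵥ (u n).ofLp) = ‖t‖ ^ 2 := by
    rw [hu, ofLp_mv, mulVec_dotProduct, Matrix.transpose_transpose, Matrix.mulVec_mulVec,
      Matrix.mulVec_mulVec, hAn, Matrix.one_mulVec, norm_sq_eq_dotProduct]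
  have hun : u n ≠ 0 := by
    intro h0
    rw [h0] at hq
    simp only [WithLp.ofLp_zero, Matrix.mulVec_zero, dotProduct_zero] at hq
    exact htn.ne' (by simpa using hq.symm)
  have hunn := norm_pos_iff.2 hun
  have hbn : b n = normalized (u n) := by simp [hb, hun]
  have hsq : √(s n) = ‖t‖ / ‖u n‖ := by
    rw [hsn, hbn]
    simp only [normalized, WithLp.ofLp_smul, Matrix.mulVec_smul, smul_dotProduct,
      dotProduct_smul, smul_eq_mul]
    rw [hq, ← Real.sqrt_sq (div_nonneg htn.le hunn.le)]
    congr 1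
    field_simp
  congr 1
  funext ω
  congr 3
  rw [hsq, hbn, inner_eq_dotProduct, ofLp_mv, mulVec_dotProduct, dotProduct_comm (z n ω).ofLp]
  have hne : ‖mv (A n)ᵀ t‖ ≠ 0 := hunn.ne'
  simp only [normalized, WithLp.ofLp_smul, smul_dotProduct, smul_eq_mul, hu, ofLp_mv]
  field_simp

end Asymptotics

/-! ### Consistency of the Gram matrix and the general limit theorem -/

section Asymptotics

variable {Ω : ℕ → Type*} [∀ n, MeasurableSpace (Ω n)] {μ : (n : ℕ) → Measure (Ω n)}
  {p : ℕ}

/-- The rate of convergence `√(m / τ)`. -/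
def rate (m : ℕ → ℕ) (τ : ℕ → ℝ) (n : ℕ) : ℝ := √(m n : ℝ) * (√(τ n))⁻¹

lemma tendsto_inv_rate {m : ℕ → ℕ} {τ : ℕ → ℝ}
    (hτm : Tendsto (fun n => τ n / (m n : ℝ)) atTop (nhds 0)) :
    Tendsto (fun n => (rate m τ n)⁻¹) atTop (nhds 0) := by
  have h := (Real.continuous_sqrt.tendsto 0).comp hτm
  rw [Real.sqrt_zero] at h
  refine h.congr fun n => ?_
  rw [Function.comp_apply, Real.sqrt_div' _ (Nat.cast_nonneg _), rate, mul_inv, inv_inv,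
    div_eq_inv_mul]

lemma eventually_rate_pos {n₀ : ℕ} {m : ℕ → ℕ} {τ : ℕ → ℝ} (hm : Tendsto m atTop atTop)
    (hτ : ∀ n ≥ n₀, 0 < τ n) : ∀ᶠ n in atTop, 0 < rate m τ n := by
  filter_upwards [hm.eventually_gt_atTop 0, eventually_ge_atTop n₀] with n h1 h2
  have h3 : (0 : ℝ) < m n := by exact_mod_cast h1
  exact mul_pos (Real.sqrt_pos.2 h3) (inv_pos.2 (Real.sqrt_pos.2 (hτ n h2)))

lemma tendsto_zero_of_boundedInProb_rate_mul {n₀ : ℕ} {m : ℕ → ℕ} {τ : ℕ → ℝ}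
    (hm : Tendsto m atTop atTop) (hτ : ∀ n ≥ n₀, 0 < τ n)
    (hτm : Tendsto (fun n => τ n / (m n : ℝ)) atTop (nhds 0)) {q : (n : ℕ) → Ω n → ℝ}
    (hq : BoundedInProb μ fun n ω => rate m τ n * q n ω) :
    Tendsto (fun s : Σ n, Ω n => q s.1 s.2) (probFilter μ) (nhds 0) := by
  refine (hq.mul_tendsto_zero ((tendsto_inv_rate hτm).comp tendsto_fst_probFilter)).congr' ?_
  filter_upwards [tendsto_fst_probFilter.eventually (eventually_rate_pos hm hτ)] with s hs
  simp only [Function.comp_apply]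
  field_simp

lemma tendsto_vec_iff {α : Type*} {l : Filter α} {f : α → Vec p} {v : Vec p} :
    Tendsto f l (nhds v) ↔ ∀ i, Tendsto (fun s => f s i) l (nhds (v i)) := by
  constructor
  · intro h i
    exact ((continuous_apply i).comp (PiLp.continuous_ofLp 2 _)).continuousAt.tendsto.comp h
  · intro h
    exact ((PiLp.continuous_toLp 2 fun _ : Fin p => ℝ).tendsto v.ofLp).comp (tendsto_pi_nhds.2 h)

lemma tendsto_mv_of_boundedInProb {z : (n : ℕ) → Ω n → Vec p}
    (hz : ∀ i, BoundedInProb μ fun n ω => z n ω i) {D : (Σ n, Ω n) → Matrix (Fin p) (Fin p) ℝ}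
    (hD : Tendsto D (probFilter μ) (nhds 0)) :
    Tendsto (fun s => mv (D s) (z s.1 s.2)) (probFilter μ) (nhds 0) := by
  refine tendsto_vec_iff.2 fun i => ?_
  have h : ∀ j, Tendsto (fun s : Σ n, Ω n => z s.1 s.2 j * D s i j) (probFilter μ) (nhds 0) :=
    fun j => (hz j).mul_tendsto_zero (tendsto_pi_nhds.1 (tendsto_pi_nhds.1 hD i) j)
  have h2 := tendsto_finsetSum Finset.univ fun j _ => h j
  simp only [Finset.sum_const_zero] at h2
  refine h2.congr fun s => ?_
  simp only [mv, Matrix.mulVec, dotProduct, mul_comm]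

lemma eventually_det_ne_zero {α : Type*} {l : Filter α} {G : α → Matrix (Fin p) (Fin p) ℝ}
    (hG : Tendsto G l (nhds 1)) : ∀ᶠ s in l, (G s).det ≠ 0 := by
  have hc : Continuous fun A : Matrix (Fin p) (Fin p) ℝ => A.det := continuous_id.matrix_det
  have h := (hc.tendsto 1).comp hG
  exact h.eventually_ne (by simp)

variable [∀ n, IsProbabilityMeasure (μ n)]

/-- Convergent laws are tight and the variances are bounded above, so pairs satisfying `𝔓` need no
separate boundedness assumption. -/
lemma OneDimForms.boundedInProb {n₀ : ℕ} {m : ℕ → ℕ} {τ : ℕ → ℝ}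
    {S : (n : ℕ) → Ω n → Matrix (Fin (m n)) (Fin n) ℝ} {𝔓 : VecSeq → VecSeq → Prop}
    {σ2 : (n : ℕ) → Vec n → Vec n → ℝ} (h : OneDimForms n₀ m τ μ S 𝔓 σ2) {a b : VecSeq}
    (ha : IsUnitSeq n₀ a) (hb : IsUnitSeq n₀ b) (hab : 𝔓 a b) :
    BoundedInProb μ fun n ω => rate m τ n * quadDev (S n ω) (a n) (b n) := by
  obtain ⟨⟨c, C, hc, hσ⟩, hlim⟩ := h a b ha hb hab
  have hbd : ∀ᶠ n in atTop, |√(σ2 n (a n) (b n))| ≤ √C := by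
    filter_upwards [eventually_ge_atTop n₀] with n hn
    rw [abs_of_nonneg (Real.sqrt_nonneg _)]
    exact Real.sqrt_le_sqrt (hσ n hn).2
  refine ((boundedInProb_of_tendstoInDistribution hlim).mul_bounded hbd).congr ?_
  filter_upwards [eventually_ge_atTop n₀] with n hn
  funext ω
  have : √(σ2 n (a n) (b n)) ≠ 0 := (Real.sqrt_pos.2 (hc.trans_le (hσ n hn).1)).ne'
  rw [rate]
  field_simp

variable {n₀ : ℕ} {m : ℕ → ℕ} {τ : ℕ → ℝ} {U : (n : ℕ) → Matrix (Fin n) (Fin p) ℝ}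
  {S : (n : ℕ) → Ω n → Matrix (Fin (m n)) (Fin n) ℝ} {𝔓 : VecSeq → VecSeq → Prop}
  {σ2 : (n : ℕ) → Vec n → Vec n → ℝ}

lemma isUnitSeq_mvSeq (hU : ∀ n ≥ n₀, (U n)ᵀ * U n = 1) {b : ℕ → Vec p} (hb : ∀ n, ‖b n‖ = 1) :
    IsUnitSeq n₀ (mvSeq U b) := fun n hn => by
  rw [mvSeq, norm_mv_of_transpose_mul_self (hU n hn), hb n]

/-- The form of `G - 1` at a fixed `b` is the centred form of the pair `(U b, U b)`, of order
`√(τ/m)` in probability; since `p` is fixed, fixed directions determine the matrix. -/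
lemma tendsto_sketchGram (hm : Tendsto m atTop atTop) (hτ : ∀ n ≥ n₀, 0 < τ n)
    (hτm : Tendsto (fun n => τ n / (m n : ℝ)) atTop (nhds 0))
    (hU : ∀ n ≥ n₀, (U n)ᵀ * U n = 1) (hOneDim : OneDimForms n₀ m τ μ S 𝔓 σ2)
    (hUU : ∀ b : ℕ → Vec p, (∀ n, ‖b n‖ = 1) → 𝔓 (mvSeq U b) (mvSeq U b)) :
    Tendsto (fun s : Σ n, Ω n => sketchGram (S s.1 s.2) (U s.1)) (probFilter μ) (nhds 1) := by
  have h : Tendsto (fun s : Σ n, Ω n => sketchGram (S s.1 s.2) (U s.1) - 1) (probFilter μ)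
      (nhds 0) := by
    refine tendsto_of_forall_quadratic_form (fun s => ?_) fun b hb => ?_
    · rw [Matrix.transpose_sub, sketchGram_transpose, Matrix.transpose_one]
    · have hu := isUnitSeq_mvSeq hU (b := fun _ => b) fun _ => hb
      refine (tendsto_zero_of_boundedInProb_rate_mul hm hτ hτm
        (hOneDim.boundedInProb hu hu (hUU _ fun _ => hb))).congr' ?_
      filter_upwards [tendsto_fst_probFilter.eventually (eventually_ge_atTop n₀)] with s hs
      rw [dotProduct_sketchGram _ (hU _ hs)]
      rfl
  simpa using h.add_const 1

lemma boundedInProb_rate_smul_sketchDev (hU : ∀ n ≥ n₀, (U n)ᵀ * U n = 1)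
    (hOneDim : OneDimForms n₀ m τ μ S 𝔓 σ2) {e : VecSeq} (he : IsUnitSeq n₀ e)
    (hP : ∀ b : ℕ → Vec p, (∀ n, ‖b n‖ = 1) → 𝔓 (mvSeq U b) e) (i : Fin p) :
    BoundedInProb μ fun n ω => (rate m τ n • sketchDev (S n ω) (U n) (e n)) i := by
  have hb : ∀ _ : ℕ, ‖(EuclideanSpace.single i 1 : Vec p)‖ = 1 := fun _ => by simp
  have h := hOneDim.boundedInProb (isUnitSeq_mvSeq hU hb) he (hP _ hb)
  refine h.congr (Eventually.of_forall fun n => ?_)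
  funext ω
  have := dotProduct_sketchDev (S n ω) (U n) (e n) (EuclideanSpace.single i 1)
  rw [mvSeq, ← this]
  simp [EuclideanSpace.single]

lemma tendsto_sketchDev (hm : Tendsto m atTop atTop) (hτ : ∀ n ≥ n₀, 0 < τ n)
    (hτm : Tendsto (fun n => τ n / (m n : ℝ)) atTop (nhds 0))
    (hU : ∀ n ≥ n₀, (U n)ᵀ * U n = 1)
    (hOneDim : OneDimForms n₀ m τ μ S 𝔓 σ2) {e : VecSeq} (he : IsUnitSeq n₀ e)
    (hP : ∀ b : ℕ → Vec p, (∀ n, ‖b n‖ = 1) → 𝔓 (mvSeq U b) e) :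
    Tendsto (fun s : Σ n, Ω n => sketchDev (S s.1 s.2) (U s.1) (e s.1)) (probFilter μ)
      (nhds 0) := by
  refine tendsto_vec_iff.2 fun i => ?_
  have h := boundedInProb_rate_smul_sketchDev hU hOneDim he hP i
  simp only [PiLp.smul_apply, smul_eq_mul] at h
  exact tendsto_zero_of_boundedInProb_rate_mul
    (q := fun n ω => (sketchDev (S n ω) (U n) (e n)) i) hm hτ hτm h

lemma exists_bounds_of_isVarianceMatrix (hp : 0 < p) (hU : ∀ n ≥ n₀, (U n)ᵀ * U n = 1)
    (hOneDim : OneDimForms n₀ m τ μ S 𝔓 σ2) {e : VecSeq} (he : IsUnitSeq n₀ e)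
    (hP : ∀ b : ℕ → Vec p, (∀ n, ‖b n‖ = 1) → 𝔓 (mvSeq U b) e)
    {M : ℕ → Matrix (Fin p) (Fin p) ℝ} (hM : IsVarianceMatrix n₀ 𝔓 σ2 U e M) :
    ∃ c C : ℝ, 0 < c ∧ ∀ n ≥ n₀, (∀ v : Fin p → ℝ, c * (v ⬝ᵥ v) ≤ v ⬝ᵥ (M n *ᵥ v)) ∧
      ∀ i j, |M n i j| ≤ C := by
  refine exists_uniform_bounds hp hM.1 fun b hb => ?_
  obtain ⟨⟨c, C, hc, hσ⟩, -⟩ := hOneDim _ _ (isUnitSeq_mvSeq hU hb) he (hP b hb)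
  refine ⟨c, C, hc, fun n hn => ?_⟩
  have := hM.2 b hb (hP b hb) n hn
  rw [← this]
  exact hσ n hn

/-- Asymptotic normality of studentized linear transformations of `√(m / τ) Uᵀ (Sᵀ S e - e)`. -/
theorem tendstoStdNormal_of_eq_studentizer (hp : 0 < p)
    (hS : ∀ n i j, Measurable fun ω => S n ω i j)
    (hm : Tendsto m atTop atTop) (hτ : ∀ n ≥ n₀, 0 < τ n)
    (hτm : Tendsto (fun n => τ n / (m n : ℝ)) atTop (nhds 0))
    (hU : ∀ n ≥ n₀, (U n)ᵀ * U n = 1) (hOneDim : OneDimForms n₀ m τ μ S 𝔓 σ2)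
    (hUU : ∀ b : ℕ → Vec p, (∀ n, ‖b n‖ = 1) → 𝔓 (mvSeq U b) (mvSeq U b))
    {e : VecSeq} (he : IsUnitSeq n₀ e)
    (hP : ∀ b : ℕ → Vec p, (∀ n, ‖b n‖ = 1) → 𝔓 (mvSeq U b) e)
    {M : ℕ → Matrix (Fin p) (Fin p) ℝ} (hM : IsVarianceMatrix n₀ 𝔓 σ2 U e M)
    {T : ℕ → Matrix (Fin p) (Fin p) ℝ} {κ : ℝ}
    (hT : ∀ᶠ n in atTop, (∀ i j, |T n i j| ≤ κ) ∧ 1 ≤ |(T n).det|)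
    {N : (Σ n, Ω n) → Matrix (Fin p) (Fin p) ℝ}
    (hN : Tendsto (fun s => N s - M s.1) (probFilter μ) (nhds 0))
    {W : (n : ℕ) → Ω n → Vec p} (hW : ∀ n, Measurable (W n))
    (hWeq : ∀ᶠ s : Σ n, Ω n in probFilter μ, W s.1 s.2 =
      mv (studentizer (T s.1) (N s) (sketchGram (S s.1 s.2) (U s.1)))
        (rate m τ s.1 • sketchDev (S s.1 s.2) (U s.1) (e s.1))) :
    TendstoStdNormal μ W := by
  obtain ⟨c, C, hc, hbd⟩ := exists_bounds_of_isVarianceMatrix hp hU hOneDim he hP hM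
  have hz : ∀ n, Measurable fun ω => rate m τ n • sketchDev (S n ω) (U n) (e n) := fun n =>
    (measurable_sketchDev (hS n) (U n) (e n)).const_smul (rate m τ n)
  -- The ideal statistic, with `N = M` and `G = 1`, carries the limit law.
  have hlin : TendstoStdNormal μ fun n ω => mv (studentizer (T n) (M n) 1)
      (rate m τ n • sketchDev (S n ω) (U n) (e n)) := by
    refine tendstoStdNormal_mv hp hz (M := M) (fun b hb => ?_) ?_
    · refine ⟨fun n => σ2 n (mv (U n) (b n)) (e n), ?_, ?_⟩
      · filter_upwards [eventually_ge_atTop n₀] with n hn using hM.2 b hb (hP b hb) n hn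
      · convert (hOneDim _ _ (isUnitSeq_mvSeq hU hb) he (hP b hb)).2 using 3 with n ω
        rw [WithLp.ofLp_smul, dotProduct_smul, dotProduct_sketchDev, smul_eq_mul, rate, mvSeq]
        ring
    · filter_upwards [hT, eventually_ge_atTop n₀] with n h1 h2
      refine studentizer_mul_mul_transpose (posDef_of_coercive hc (hM.1 n h2) (hbd n h2).1) ?_
      intro h0
      have := h1.2
      rw [h0] at this
      norm_num at this
  -- The actual statistic differs from it by a matrix tending to zero in probability, applied to a
  -- vector bounded in probability.
  refine hlin.of_tendsto_sub (fun n => (hW n).aemeasurable) ?_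
  have hK : ∀ᶠ s : Σ n, Ω n in probFilter μ,
      (T s.1, M s.1, 1) ∈ studentizerDomain p κ c C := by
    filter_upwards [tendsto_fst_probFilter.eventually hT,
      tendsto_fst_probFilter.eventually (eventually_ge_atTop n₀)] with s h1 h2
    exact ⟨h1.1, h1.2, hM.1 _ h2, (hbd _ h2).2, (hbd _ h2).1, rfl⟩
  have hG := tendsto_sketchGram (S := S) hm hτ hτm hU hOneDim hUU
  have hlim := tendsto_mv_of_boundedInProb
    (boundedInProb_rate_smul_sketchDev hU hOneDim he hP) (tendsto_studentizer_sub hc hK hN hG)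
  refine hlim.congr' ?_
  filter_upwards [hWeq] with s hs
  rw [hs, sub_mv]

end Asymptotics

/-! ### Normalization by the largest singular value -/

section Scale

variable {p : ℕ}

/-- For `|θ| = ℓ₁` the ratios `|θ| / ℓ_i` lie between `1` and the condition number, while the
orthogonal `V` has entries at most `1` and determinant `±1`. -/
lemma exists_scale_bounds (hp : 0 < p) {n₀ : ℕ} {X U : (n : ℕ) → Matrix (Fin n) (Fin p) ℝ}
    {ℓ : ℕ → Fin p → ℝ} {V : ℕ → Matrix (Fin p) (Fin p) ℝ}
    (hSVD : ∀ n ≥ n₀, IsSVD (X n) (U n) (ℓ n) (V n)) (hcond : BoundedCondNumber hp ℓ)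
    {θ : ℕ → ℝ} (hθ : ∀ n, |θ n| = |ℓ n ⟨0, hp⟩|) :
    ∃ κ : ℝ, ∀ᶠ n in atTop, (∀ i j, |(V n * diagonal fun i => θ n / ℓ n i) i j| ≤ κ) ∧
      1 ≤ |(V n * diagonal fun i => θ n / ℓ n i).det| := by
  obtain ⟨κ, hκ⟩ := hcond
  refine ⟨κ, ?_⟩
  filter_upwards [eventually_map.1 hκ, eventually_ge_atTop n₀] with n h1 h2
  have h := hSVD n h2
  have habs : ∀ i, |θ n / ℓ n i| = ℓ n ⟨0, hp⟩ / ℓ n i := fun i => by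
    rw [abs_div, hθ, abs_of_pos (h.pos _), abs_of_pos (h.pos i)]
  constructor
  · intro i j
    rw [Matrix.mul_diagonal, abs_mul, habs]
    have h3 : ℓ n ⟨0, hp⟩ / ℓ n j ≤ κ := by
      refine le_trans ?_ h1
      refine div_le_div_of_nonneg_left (h.pos _).le (h.pos _) (h.anti ?_)
      exact Fin.mk_le_mk.2 (Nat.le_sub_one_of_lt j.2)
    have h4 := abs_apply_le_one_of_transpose_mul_self h.orthV i j
    have h5 : 0 ≤ ℓ n ⟨0, hp⟩ / ℓ n j := (div_pos (h.pos _) (h.pos _)).le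
    calc |V n i j| * (ℓ n ⟨0, hp⟩ / ℓ n j) ≤ 1 * (ℓ n ⟨0, hp⟩ / ℓ n j) := by gcongr
      _ ≤ κ := by rwa [one_mul]
  · rw [Matrix.det_mul, abs_mul, abs_det_eq_one_of_transpose_mul_self h.orthV, one_mul,
      Matrix.det_diagonal, Finset.abs_prod]
    refine Finset.one_le_prod fun i _ => ?_
    rw [habs, one_le_div (h.pos i)]
    exact h.anti (Fin.mk_le_mk.2 (Nat.zero_le _))

end Scale

/-! ### Covariance identities and their limits -/

section Algebra

variable {n p m : ℕ}

/-- The scale `k` is linear in the error and quadratic in the covariance, so it cancels; no bounds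
on the sizes of `X` and `y` are needed. -/
lemma smul_mv_inv_matSqrt_eq_mv_studentizer {N : Matrix (Fin p) (Fin p) ℝ} (hN : N.PosSemidef)
    (T G : Matrix (Fin p) (Fin p) ℝ) {k : ℝ} (hk : 0 < k) (r : ℝ) (v : Vec p) :
    r • mv (matSqrt (k ^ 2 • (T * N * Tᵀ)))⁻¹ (k • mv T (mv G⁻¹ v)) =
      mv (studentizer T N G) (r • v) := by
  rw [inv_matSqrt_sq_smul hN T hk, studentizer, mv_mul, mv_mul, smul_mv, mv_smul, mv_smul, mv_smul,
    mv_smul, smul_smul k⁻¹, inv_mul_cancel₀ hk.ne', one_smul]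

lemma outer_smul (c : ℝ) (v : Vec p) : outer (c • v) = c ^ 2 • outer v := by
  ext i j
  simp [outer, Matrix.vecMulVec_apply]
  ring

lemma outer_mv (T : Matrix (Fin p) (Fin p) ℝ) (v : Vec p) :
    outer (mv T v) = T * outer v * Tᵀ := by
  rw [outer, outer, Matrix.mul_vecMulVec, Matrix.vecMulVec_mul, Matrix.vecMul_transpose, ofLp_mv]

lemma dotProduct_outer (v w : Vec p) :
    w.ofLp ⬝ᵥ (outer v *ᵥ w.ofLp) = (w.ofLp ⬝ᵥ v.ofLp) ^ 2 := by
  rw [outer, Matrix.vecMulVec_mulVec, dotProduct_comm v.ofLp w.ofLp]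
  simp [sq]

namespace IsOrthFactor

variable {X U : Matrix (Fin n) (Fin p) ℝ} {T : Matrix (Fin p) (Fin p) ℝ} {θ : ℝ}

/-- Brings the root of the sketched Gram matrix into the inverse-root form of `studentizer`. -/
lemma matSqrt_gram (h : IsOrthFactor X U T θ) {S : Matrix (Fin m) (Fin n) ℝ}
    (hG : (sketchGram S U).det ≠ 0) :
    matSqrt ((S * X)ᵀ * (S * X)) =
      (matSqrt (θ⁻¹ ^ 2 • (T * (sketchGram S U)⁻¹ * Tᵀ)))⁻¹ := by
  have hinv := h.inv_gram S
  have hdet : IsUnit ((S * X)ᵀ * (S * X)).det := by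
    have h1 : (((S * X)ᵀ * (S * X))⁻¹).det ≠ 0 := by
      rw [hinv, Matrix.det_smul, Matrix.det_mul, Matrix.det_mul, Matrix.det_transpose]
      refine mul_ne_zero (pow_ne_zero _ (pow_ne_zero _ (inv_ne_zero h.ne_zero)))
        (mul_ne_zero (mul_ne_zero h.det_ne ?_) h.det_ne)
      rw [Matrix.det_nonsing_inv, Ring.inverse_eq_inv']
      exact inv_ne_zero hG
    rw [Matrix.det_nonsing_inv, Ring.inverse_eq_inv'] at h1
    exact isUnit_iff_ne_zero.2 fun h0 => h1 (by rw [h0, _root_.inv_zero])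
  rw [← hinv, ← matSqrt_inv (posSemidef_gram (S * X)).inv, Matrix.nonsing_inv_nonsing_inv _ hdet]

lemma mv_transpose_eq (h : IsOrthFactor X U T θ) (y : Vec n) :
    mv Uᵀ y = ‖fitted X y‖ • mv Uᵀ (normalized (fitted X y)) := by
  rw [← mv_smul, norm_smul_normalized, h.fitted_eq, ← mv_mul Uᵀ U, h.orthU, one_mv]

lemma norm_mv_transpose_normalized_fitted (h : IsOrthFactor X U T θ) {y : Vec n}
    (hy : fitted X y ≠ 0) : ‖mv Uᵀ (normalized (fitted X y))‖ = 1 := by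
  have h1 := norm_mv_of_transpose_mul_self h.orthU (mv Uᵀ y)
  rw [← h.fitted_eq, h.mv_transpose_eq, norm_smul, norm_norm] at h1
  exact (mul_eq_left₀ (norm_ne_zero_iff.2 hy)).1 h1.symm

end IsOrthFactor

/-- The matrix `(hᵀ G h) G⁻¹ + a h hᵀ` with `h = G⁻¹ g`. -/
def partialCov (a : ℝ) (g : Vec p) (G : Matrix (Fin p) (Fin p) ℝ) : Matrix (Fin p) (Fin p) ℝ :=
  ((mv G⁻¹ g).ofLp ⬝ᵥ (G *ᵥ (mv G⁻¹ g).ofLp)) • G⁻¹ + a • outer (mv G⁻¹ g)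

lemma partialCov_one (a : ℝ) {g : Vec p} (hg : ‖g‖ = 1) : partialCov a g 1 = 1 + a • outer g := by
  simp only [partialCov, inv_one, one_mv, Matrix.one_mulVec, ← norm_sq_eq_dotProduct, hg, one_pow,
    one_smul]

lemma dotProduct_sketchGram_self (S : Matrix (Fin m) (Fin n) ℝ) (U : Matrix (Fin n) (Fin p) ℝ)
    (v : Vec p) : v.ofLp ⬝ᵥ (sketchGram S U *ᵥ v.ofLp) = ‖mv (S * U) v‖ ^ 2 := by
  rw [norm_sq_eq_dotProduct, ofLp_mv, mulVec_dotProduct, Matrix.mulVec_mulVec, sketchGram]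

lemma posSemidef_partialCov {a : ℝ} (ha : 0 ≤ a) (g : Vec p) (S : Matrix (Fin m) (Fin n) ℝ)
    (U : Matrix (Fin n) (Fin p) ℝ) : (partialCov a g (sketchGram S U)).PosSemidef := by
  rw [partialCov, dotProduct_sketchGram_self]
  exact ((posSemidef_gram (S * U)).inv.smul (sq_nonneg _)).add ((posSemidef_outer _).smul ha)

/-- Both terms are quadratic in `‖X β‖ / θ`, which factors out. It is written with `|θ|` because the
scale must be positive while `θ` will be negative. -/
lemma IsOrthFactor.partialSketch_cov_eq {X U : Matrix (Fin n) (Fin p) ℝ}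
    {T : Matrix (Fin p) (Fin p) ℝ} {θ : ℝ} (h : IsOrthFactor X U T θ)
    (S : Matrix (Fin m) (Fin n) ℝ) (y : Vec n) (a : ℝ) :
    ‖mv (S * X) (partialSketch S X y)‖ ^ 2 • ((S * X)ᵀ * (S * X))⁻¹ +
        a • outer (partialSketch S X y) =
      (|θ|⁻¹ * ‖fitted X y‖) ^ 2 • (T *
        partialCov a (mv Uᵀ (normalized (fitted X y))) (sketchGram S U) * Tᵀ) := by
  have h1 : partialSketch S X y = (θ⁻¹ * ‖fitted X y‖) •
      mv T (mv (sketchGram S U)⁻¹ (mv Uᵀ (normalized (fitted X y)))) := by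
    rw [h.partialSketch_eq, h.mv_transpose_eq, mv_smul, mv_smul, smul_smul]
  have h2 : ∀ v, mv (S * X) (mv T v) = θ • mv (S * U) v := fun v => by
    rw [← mv_mul, Matrix.mul_assoc, h.eq, Matrix.mul_smul, smul_mv]
  have h3 : ‖mv (S * X) (partialSketch S X y)‖ ^ 2 = ‖fitted X y‖ ^ 2 *
      ‖mv (S * U) (mv (sketchGram S U)⁻¹ (mv Uᵀ (normalized (fitted X y))))‖ ^ 2 := by
    rw [h1, mv_smul, h2, smul_smul, mul_right_comm, inv_mul_cancel₀ h.ne_zero, one_mul, norm_smul,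
      norm_norm, mul_pow]
  rw [h3, h1, outer_smul, outer_mv, h.inv_gram, partialCov, dotProduct_sketchGram_self,
    Matrix.mul_add, Matrix.add_mul, smul_add]
  simp only [Matrix.mul_smul, Matrix.smul_mul, smul_smul, mul_pow, inv_pow, sq_abs]
  congr 2
  · ring
  · ring

lemma continuousAt_partialCov (a : ℝ) (g : Vec p) :
    ContinuousAt (fun x : Vec p × Matrix (Fin p) (Fin p) ℝ => partialCov a x.1 x.2) (g, 1) := by
  have hinv : ContinuousAt (fun x : Vec p × Matrix (Fin p) (Fin p) ℝ => x.2⁻¹) (g, 1) :=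
    ContinuousAt.comp (g := fun A : Matrix (Fin p) (Fin p) ℝ => A⁻¹)
      (continuousAt_matrix_inv (by simp)) continuousAt_snd
  have hh : ContinuousAt (fun x : Vec p × Matrix (Fin p) (Fin p) ℝ => mv x.2⁻¹ x.1) (g, 1) :=
    continuous_mv.continuousAt.comp₂ hinv continuousAt_fst
  have hq : Continuous fun x : Vec p × Matrix (Fin p) (Fin p) ℝ =>
      x.1.ofLp ⬝ᵥ (x.2 *ᵥ x.1.ofLp) :=
    ((PiLp.continuous_ofLp 2 _).comp continuous_fst).dotProduct
      (continuous_snd.matrix_mulVec ((PiLp.continuous_ofLp 2 _).comp continuous_fst))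
  exact ((hq.continuousAt.comp₂ hh continuousAt_snd).smul hinv).add
    ((continuous_outer.continuousAt.comp hh).const_smul a)

/-- The vector `g` need not converge, but it moves on the compact unit sphere. -/
lemma tendsto_partialCov_sub {α : Type*} {l : Filter α} (a : ℝ) {g : α → Vec p}
    {G : α → Matrix (Fin p) (Fin p) ℝ} (hg : ∀ᶠ s in l, ‖g s‖ = 1) (hG : Tendsto G l (nhds 1)) :
    Tendsto (fun s => partialCov a (g s) (G s) - (1 + a • outer (g s))) l (nhds 0) := by
  have hK : IsCompact (Metric.sphere (0 : Vec p) 1 ×ˢ {(1 : Matrix (Fin p) (Fin p) ℝ)}) :=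
    (isCompact_sphere _ _).prod isCompact_singleton
  have hcont : ∀ x ∈ Metric.sphere (0 : Vec p) 1 ×ˢ {(1 : Matrix (Fin p) (Fin p) ℝ)},
      ContinuousAt (fun x : Vec p × Matrix (Fin p) (Fin p) ℝ => partialCov a x.1 x.2) x := by
    rintro ⟨g, A⟩ ⟨-, hA⟩
    obtain rfl : A = 1 := hA
    exact continuousAt_partialCov a g
  have hx : ∀ᶠ s in l, (g s, (1 : Matrix (Fin p) (Fin p) ℝ)) ∈
      Metric.sphere (0 : Vec p) 1 ×ˢ {(1 : Matrix (Fin p) (Fin p) ℝ)} := by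
    filter_upwards [hg] with s hs
    exact ⟨by simpa using hs, rfl⟩
  have hxy : Tendsto (fun s => ((g s, (1 : Matrix (Fin p) (Fin p) ℝ)), (g s, G s))) l
      (uniformity _) := by
    rw [uniformity_eq_comap_nhds_zero, tendsto_comap_iff]
    have h1 : Tendsto (fun s => G s - 1) l (nhds 0) := by
      simpa using hG.sub_const 1
    refine ((tendsto_const_nhds (x := (0 : Vec p))).prodMk_nhds h1).congr fun s => ?_
    simp
  have key := tendsto_uniformity_of_isCompact
    (F := fun x : Vec p × Matrix (Fin p) (Fin p) ℝ => partialCov a x.1 x.2)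
    (x := fun s => (g s, 1)) (y := fun s => (g s, G s)) hK hcont hx hxy
  rw [uniformity_eq_comap_nhds_zero, tendsto_comap_iff] at key
  refine key.congr' ?_
  filter_upwards [hg] with s hs
  rw [Function.comp_apply, partialCov_one a hs]

lemma tendsto_sketched_residual_form {α : Type*} {l : Filter α} {q : α → ℝ} {v : α → Vec p}
    {G : α → Matrix (Fin p) (Fin p) ℝ} (hq : Tendsto q l (nhds 0)) (hv : Tendsto v l (nhds 0))
    (hG : Tendsto G l (nhds 1)) :
    Tendsto (fun s => 1 + q s - 2 * ((mv (G s)⁻¹ (v s)).ofLp ⬝ᵥ (v s).ofLp) +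
      (mv (G s)⁻¹ (v s)).ofLp ⬝ᵥ (G s *ᵥ (mv (G s)⁻¹ (v s)).ofLp)) l (nhds 1) := by
  have hinv : Tendsto (fun s => (G s)⁻¹) l (nhds 1) := by
    have h := (continuousAt_matrix_inv (p := p) (A := 1) (by simp)).tendsto.comp hG
    simpa [Function.comp_def] using h
  have hw : Tendsto (fun s => mv (G s)⁻¹ (v s)) l (nhds 0) := by
    have h := (continuous_mv.tendsto ((1 : Matrix (Fin p) (Fin p) ℝ), (0 : Vec p))).comp
      (hinv.prodMk_nhds hv)
    simpa [Function.comp_def] using h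
  have h1 : Continuous fun x : Vec p × Vec p => x.1.ofLp ⬝ᵥ x.2.ofLp :=
    ((PiLp.continuous_ofLp 2 _).comp continuous_fst).dotProduct
      ((PiLp.continuous_ofLp 2 _).comp continuous_snd)
  have h2 : Continuous fun x : Vec p × Matrix (Fin p) (Fin p) ℝ =>
      x.1.ofLp ⬝ᵥ (x.2 *ᵥ x.1.ofLp) :=
    ((PiLp.continuous_ofLp 2 _).comp continuous_fst).dotProduct
      (continuous_snd.matrix_mulVec ((PiLp.continuous_ofLp 2 _).comp continuous_fst))
  have h3 := (h1.tendsto (0, 0)).comp (hw.prodMk_nhds hv)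
  have h4 := (h2.tendsto (0, 1)).comp (hw.prodMk_nhds hG)
  have h5 := ((hq.const_add 1).sub (h3.const_mul 2)).add h4
  simpa using h5

end Algebra

/-! ### The special variance form and the residual norm -/

section Main

variable {Ω : ℕ → Type*} [∀ n, MeasurableSpace (Ω n)] {μ : (n : ℕ) → Measure (Ω n)}
  [∀ n, IsProbabilityMeasure (μ n)] {p n₀ : ℕ} {m : ℕ → ℕ} {τ : ℕ → ℝ}
  {X U : (n : ℕ) → Matrix (Fin n) (Fin p) ℝ} {y : VecSeq}
  {S : (n : ℕ) → Ω n → Matrix (Fin (m n)) (Fin n) ℝ} {𝔓 : VecSeq → VecSeq → Prop}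
  {σ2 : (n : ℕ) → Vec n → Vec n → ℝ} {T : ℕ → Matrix (Fin p) (Fin p) ℝ} {θ : ℕ → ℝ}

/-- `(U b)ᵀ e = bᵀ (Uᵀ e)`, so its square is a rank-one form in `b`, and the constant `1` is `‖b‖²`.
-/
lemma isVarianceMatrix_of_specialVariance (hU : ∀ n ≥ n₀, (U n)ᵀ * U n = 1) {e : VecSeq}
    (he : IsUnitSeq n₀ e) {α : ℝ} (h : SpecialVariance n₀ 𝔓 σ2 α) :
    IsVarianceMatrix n₀ 𝔓 σ2 U e fun n => 1 + (α + 1) • outer (mv (U n)ᵀ (e n)) := by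
  constructor
  · intro n _
    have := transpose_eq_of_isHermitian (posSemidef_outer (mv (U n)ᵀ (e n))).1
    simp [Matrix.IsSymm, this]
  · intro b hb hP n hn
    have h1 := h _ _ (isUnitSeq_mvSeq hU hb) he hP n hn
    have h2 : (b n).ofLp ⬝ᵥ (b n).ofLp = 1 := by
      rw [← norm_sq_eq_dotProduct, hb n, one_pow]
    rw [mvSeq] at h1
    rw [h1, Matrix.add_mulVec, Matrix.one_mulVec, Matrix.smul_mulVec, dotProduct_add, h2,
      dotProduct_smul, dotProduct_outer, smul_eq_mul, ofLp_mv, mulVec_dotProduct, ofLp_mv]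

/-- The square of `‖ε̃‖ / ‖ε‖` tends to one in probability. -/
lemma tendsto_norm_sketched_residual (hm : Tendsto m atTop atTop) (hτ : ∀ n ≥ n₀, 0 < τ n)
    (hτm : Tendsto (fun n => τ n / (m n : ℝ)) atTop (nhds 0))
    (hX : ∀ n ≥ n₀, IsOrthFactor (X n) (U n) (T n) (θ n))
    (hy : ∀ n ≥ n₀, residual (X n) (y n) ≠ 0)
    (hOneDim : OneDimForms n₀ m τ μ S 𝔓 σ2)
    (hUU : ∀ b : ℕ → Vec p, (∀ n, ‖b n‖ = 1) → 𝔓 (mvSeq U b) (mvSeq U b))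
    (hP : ∀ b : ℕ → Vec p, (∀ n, ‖b n‖ = 1) →
      𝔓 (mvSeq U b) (fun n => normalized (residual (X n) (y n))))
    (hB : BoundedInProb μ fun n ω => rate m τ n *
      quadDev (S n ω) (normalized (residual (X n) (y n))) (normalized (residual (X n) (y n)))) :
    Tendsto (fun s : Σ n, Ω n => (‖mv (S s.1 s.2) (y s.1) -
        mv (S s.1 s.2 * X s.1) (sketchSolve (S s.1 s.2) (X s.1) (y s.1))‖ /
          ‖residual (X s.1) (y s.1)‖) ^ 2) (probFilter μ) (nhds 1) := by
  have hU : ∀ n ≥ n₀, (U n)ᵀ * U n = 1 := fun n hn => (hX n hn).orthU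
  have hG := tendsto_sketchGram (S := S) hm hτ hτm hU hOneDim hUU
  have hv := tendsto_sketchDev hm hτ hτm hU hOneDim (fun n hn => norm_normalized (hy n hn)) hP
  refine (tendsto_sketched_residual_form
    (tendsto_zero_of_boundedInProb_rate_mul hm hτ hτm hB) hv hG).congr' ?_
  filter_upwards [eventually_det_ne_zero hG,
    tendsto_fst_probFilter.eventually (eventually_ge_atTop n₀)] with s h1 h2
  exact ((hX _ h2).norm_sketched_residual_sq h1 (hy _ h2)).symm

end Main

end SketchedLS

end

/-! ### Assembly of the four limit statements -/

open SketchedLS in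
theorem theorem1
    {p : ℕ} (hp : 0 < p)
    -- all sequences are considered from the index `n₀` on
    (n₀ : ℕ)
    -- sketch sizes `m = m_n` and scalars `τ_n = τ_{m_n,n}`
    (m : ℕ → ℕ) (hm : Tendsto m atTop atTop) (hmn : ∀ n ≥ n₀, m n < n)
    (τ : ℕ → ℝ) (hτ : ∀ n ≥ n₀, 0 < τ n)
    (hτm : Tendsto (fun n => τ n / (m n : ℝ)) atTop (nhds 0))
    -- the deterministic data, with a singular value decomposition of bounded condition number
    (X : (n : ℕ) → Matrix (Fin n) (Fin p) ℝ) (y : VecSeq)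
    (U : (n : ℕ) → Matrix (Fin n) (Fin p) ℝ) (ℓ : ℕ → Fin p → ℝ)
    (V : ℕ → Matrix (Fin p) (Fin p) ℝ)
    (hSVD : ∀ n ≥ n₀, IsSVD (X n) (U n) (ℓ n) (V n))
    (hcond : BoundedCondNumber hp ℓ)
    -- the random sketching matrices
    {Ω : ℕ → Type*} [∀ n, MeasurableSpace (Ω n)]
    (μ : (n : ℕ) → Measure (Ω n)) [∀ n, IsProbabilityMeasure (μ n)]
    (S : (n : ℕ) → Ω n → Matrix (Fin (m n)) (Fin n) ℝ)
    (hS : ∀ n i j, Measurable fun ω => S n ω i j)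
    -- the abstract conditions on pairs of sequences of vectors, and the variance function
    (𝔭 𝔓 : VecSeq → VecSeq → Prop) (σ2 : (n : ℕ) → Vec n → Vec n → ℝ)
    (hBounded : BoundedForms n₀ m τ μ S 𝔭)
    (hOneDim : OneDimForms n₀ m τ μ S 𝔓 σ2)
    (hUU : ∀ b : ℕ → Vec p, (∀ n, ‖b n‖ = 1) → 𝔓 (mvSeq U b) (mvSeq U b)) :
    -- sketch-and-solve
    ((∀ n ≥ n₀, residual (X n) (y n) ≠ 0) →
      (∀ b : ℕ → Vec p, (∀ n, ‖b n‖ = 1) →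
        𝔓 (mvSeq U b) (fun n => normalized (residual (X n) (y n)))) →
      -- limiting distribution
      (∀ M : ℕ → Matrix (Fin p) (Fin p) ℝ,
        IsVarianceMatrix n₀ 𝔓 σ2 U (fun n => normalized (residual (X n) (y n))) M →
        TendstoStdNormal μ fun n ω =>
          (√(m n : ℝ) * (√(τ n))⁻¹) • mv (matSqrt (limitCov (V n) (ℓ n) (M n)))⁻¹
            (‖residual (X n) (y n)‖⁻¹ •
              (sketchSolve (S n ω) (X n) (y n) - lsCoef (X n) (y n)))) ∧
      -- inference
      (∀ α : ℝ, α = 0 ∨ α = 1 → SpecialVariance n₀ 𝔓 σ2 α →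
        𝔭 (fun n => normalized (residual (X n) (y n)))
          (fun n => normalized (residual (X n) (y n))) →
        TendstoStdNormal μ fun n ω =>
          (√(m n : ℝ) * (√(τ n))⁻¹ *
            ‖mv (S n ω) (y n) - mv (S n ω * X n) (sketchSolve (S n ω) (X n) (y n))‖⁻¹) •
            mv (matSqrt ((S n ω * X n)ᵀ * (S n ω * X n)))
              (sketchSolve (S n ω) (X n) (y n) - lsCoef (X n) (y n)))) ∧
    -- partial sketching
    ((∀ n ≥ n₀, fitted (X n) (y n) ≠ 0) →
      (∀ b : ℕ → Vec p, (∀ n, ‖b n‖ = 1) →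
        𝔓 (mvSeq U b) (fun n => normalized (fitted (X n) (y n)))) →
      -- limiting distribution
      (∀ M' : ℕ → Matrix (Fin p) (Fin p) ℝ,
        IsVarianceMatrix n₀ 𝔓 σ2 U (fun n => normalized (fitted (X n) (y n))) M' →
        TendstoStdNormal μ fun n ω =>
          (√(m n : ℝ) * (√(τ n))⁻¹) • mv (matSqrt (limitCov (V n) (ℓ n) (M' n)))⁻¹
            (‖fitted (X n) (y n)‖⁻¹ •
              (partialSketch (S n ω) (X n) (y n) - lsCoef (X n) (y n)))) ∧
      -- inference
      (∀ α : ℝ, α = 0 ∨ α = 1 → SpecialVariance n₀ 𝔓 σ2 α →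
        TendstoStdNormal μ fun n ω =>
          (√(m n : ℝ) * (√(τ n))⁻¹) •
            mv (matSqrt
              (‖mv (S n ω * X n) (partialSketch (S n ω) (X n) (y n))‖ ^ 2 •
                  ((S n ω * X n)ᵀ * (S n ω * X n))⁻¹ +
                (α + 1) • outer (partialSketch (S n ω) (X n) (y n))))⁻¹
              (partialSketch (S n ω) (X n) (y n) - lsCoef (X n) (y n)))) := by

  have hU : ∀ n ≥ n₀, (U n)ᵀ * U n = 1 := fun n hn => (hSVD n hn).orthU
  have hG := tendsto_sketchGram (S := S) hm hτ hτm hU hOneDim hUU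
  have hdet := eventually_det_ne_zero hG
  have hge := tendsto_fst_probFilter (μ := μ) |>.eventually (eventually_ge_atTop n₀)
  have hℓ : ∀ n ≥ n₀, 0 < ℓ n ⟨0, hp⟩ := fun n hn => (hSVD n hn).pos _
  -- `θ = ℓ₁` is used for sketch-and-solve, and `θ = -ℓ₁` for partial sketching, where it cancels
  -- the sign of the error.
  obtain ⟨κ, hκ⟩ := exists_scale_bounds hp hSVD hcond (θ := fun n => ℓ n ⟨0, hp⟩) fun _ => rfl
  obtain ⟨κ', hκ'⟩ := exists_scale_bounds hp hSVD hcond (θ := fun n => -ℓ n ⟨0, hp⟩)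
    fun _ => abs_neg _
  have hX := fun n hn => (hSVD n hn).isOrthFactor (hℓ n hn).ne'
  have hX' := fun n hn => (hSVD n hn).isOrthFactor (neg_ne_zero.2 (hℓ n hn).ne')
  refine ⟨fun hε hP => ?_, fun hε hP => ?_⟩
  · have he : IsUnitSeq n₀ fun n => normalized (residual (X n) (y n)) :=
      fun n hn => norm_normalized (hε n hn)
    refine ⟨fun M hM => ?_, fun α hα hspec h𝔭 => ?_⟩
    · obtain ⟨c, C, hc, hbd⟩ := exists_bounds_of_isVarianceMatrix hp hU hOneDim he hP hM
      refine tendstoStdNormal_of_eq_studentizer hp hS hm hτ hτm hU hOneDim hUU he hP hM hκ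
        (N := fun s => M s.1) (by simpa using tendsto_const_nhds) (fun n => ?_) ?_
      · exact measurable_smul_mv_smul_sub (measurable_sketchSolve (hS n) (X n) (y n)) _ _ _ _
      · filter_upwards [hdet, hge] with s h1 h2
        have hne := norm_ne_zero_iff.2 (hε _ h2)
        rw [(hX _ h2).sketchSolve_sub_lsCoef h1, limitCov_eq _ (hSVD _ h2).pos _ (hℓ _ h2).ne',
          smul_smul, mul_comm (ℓ s.1 ⟨0, hp⟩)⁻¹, inv_mul_cancel_left₀ hne]
        exact smul_mv_inv_matSqrt_eq_mv_studentizer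
          (posDef_of_coercive hc (hM.1 _ h2) (hbd _ h2).1).posSemidef _ _
          (inv_pos.2 (hℓ _ h2)) _ _
    · have hs := tendsto_norm_sketched_residual hm hτ hτm hX hε hOneDim hUU hP
        (hBounded _ _ he he h𝔭)
      -- `Uᵀ` annihilates the residual, so the rank-one term vanishes for either `α`.
      have hM : IsVarianceMatrix n₀ 𝔓 σ2 U (fun n => normalized (residual (X n) (y n)))
          fun n => 1 := by
        have h := isVarianceMatrix_of_specialVariance hU he hspec
        refine ⟨fun n _ => Matrix.transpose_one, fun b hb hPb n hn => ?_⟩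
        have h0 : mv (U n)ᵀ (normalized (residual (X n) (y n))) = 0 := by
          rw [normalized, mv_smul, (hX n hn).mv_transpose_residual, smul_zero]
        rw [h.2 b hb hPb n hn]
        simp [h0, outer]
      -- `N = (‖ε̃‖/‖ε‖)² G⁻¹` tends to `1`, and `k² T N Tᵀ = (X̃ᵀ X̃)⁻¹` for `k = ‖ε‖ / (ℓ₁ ‖ε̃‖)`.
      refine tendstoStdNormal_of_eq_studentizer hp hS hm hτ hτm hU hOneDim hUU he hP hM hκ
        (N := fun s => (‖mv (S s.1 s.2) (y s.1) -
          mv (S s.1 s.2 * X s.1) (sketchSolve (S s.1 s.2) (X s.1) (y s.1))‖ /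
          ‖residual (X s.1) (y s.1)‖) ^ 2 • (sketchGram (S s.1 s.2) (U s.1))⁻¹) ?_ (fun n => ?_) ?_
      · have hinv := (continuousAt_matrix_inv (p := p) (A := 1) (by simp)).tendsto.comp hG
        have h := (hs.smul hinv).sub_const 1
        simpa [Function.comp_def] using h
      · exact measurable_studentized_sketchSolve (hS n) (X n) (y n) _
      · filter_upwards [hdet, hge, hs.eventually_ne one_ne_zero] with s h1 h2 h3
        have hne := norm_ne_zero_iff.2 (hε _ h2)
        have hℓs := hℓ _ h2
        set a := ‖mv (S s.1 s.2) (y s.1) -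
          mv (S s.1 s.2 * X s.1) (sketchSolve (S s.1 s.2) (X s.1) (y s.1))‖ with ha
        -- The ratio of norms tends to one, which excludes `ε̃ = 0` with probability tending to one.
        have ha0 : a ≠ 0 := fun h0 => h3 (by rw [h0]; simp)
        have hapos : 0 < a := lt_of_le_of_ne (norm_nonneg _) ha0.symm
        have hrpos : 0 < ‖residual (X s.1) (y s.1)‖ := norm_pos_iff.2 (hε _ h2)
        have hk : 0 < (ℓ s.1 ⟨0, hp⟩)⁻¹ * ‖residual (X s.1) (y s.1)‖ * a⁻¹ := by positivity
        rw [(hX _ h2).sketchSolve_sub_lsCoef h1, (hX _ h2).matSqrt_gram h1,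
          ← smul_mv_inv_matSqrt_eq_mv_studentizer
            ((posSemidef_sketchGram (S s.1 s.2) (U s.1)).inv.smul (sq_nonneg _)) _ _ hk]
        have h4 : ((ℓ s.1 ⟨0, hp⟩)⁻¹ * ‖residual (X s.1) (y s.1)‖ * a⁻¹) ^ 2 •
            ((V s.1 * diagonal fun i => ℓ s.1 ⟨0, hp⟩ / ℓ s.1 i) *
              ((a / ‖residual (X s.1) (y s.1)‖) ^ 2 • (sketchGram (S s.1 s.2) (U s.1))⁻¹) *
                (V s.1 * diagonal fun i => ℓ s.1 ⟨0, hp⟩ / ℓ s.1 i)ᵀ) =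
            (ℓ s.1 ⟨0, hp⟩)⁻¹ ^ 2 • ((V s.1 * diagonal fun i => ℓ s.1 ⟨0, hp⟩ / ℓ s.1 i) *
              (sketchGram (S s.1 s.2) (U s.1))⁻¹ *
                (V s.1 * diagonal fun i => ℓ s.1 ⟨0, hp⟩ / ℓ s.1 i)ᵀ) := by
          rw [Matrix.mul_smul, Matrix.smul_mul, smul_smul]
          congr 1
          field_simp
        rw [h4, mv_smul, mv_smul, smul_smul, smul_smul, rate]
        congr 1
        ring
  · have he : IsUnitSeq n₀ fun n => normalized (fitted (X n) (y n)) :=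
      fun n hn => norm_normalized (hε n hn)
    refine ⟨fun M hM => ?_, fun α hα hspec => ?_⟩
    · obtain ⟨c, C, hc, hbd⟩ := exists_bounds_of_isVarianceMatrix hp hU hOneDim he hP hM
      refine tendstoStdNormal_of_eq_studentizer hp hS hm hτ hτm hU hOneDim hUU he hP hM hκ'
        (N := fun s => M s.1) (by simpa using tendsto_const_nhds) (fun n => ?_) ?_
      · exact measurable_smul_mv_smul_sub (measurable_partialSketch (hS n) (X n) (y n)) _ _ _ _
      · filter_upwards [hdet, hge] with s h1 h2
        have hne := norm_ne_zero_iff.2 (hε _ h2)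
        rw [(hX' _ h2).partialSketch_sub_lsCoef h1,
          limitCov_eq _ (hSVD _ h2).pos _ (neg_ne_zero.2 (hℓ _ h2).ne'), ← neg_smul,
          smul_smul, inv_neg, neg_mul, neg_neg, mul_comm (ℓ s.1 ⟨0, hp⟩)⁻¹,
          inv_mul_cancel_left₀ hne, neg_sq]
        exact smul_mv_inv_matSqrt_eq_mv_studentizer
          (posDef_of_coercive hc (hM.1 _ h2) (hbd _ h2).1).posSemidef _ _
          (inv_pos.2 (hℓ _ h2)) _ _
    · have hα0 : 0 ≤ α + 1 := by rcases hα with rfl | rfl <;> norm_num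
      -- Here `N` is the estimated covariance with scale and `T` removed; it approaches `1 + (α + 1)
      -- g gᵀ`, where `g = Uᵀ e` is a unit vector.
      refine tendstoStdNormal_of_eq_studentizer hp hS hm hτ hτm hU hOneDim hUU he hP
        (isVarianceMatrix_of_specialVariance hU he hspec) hκ'
        (N := fun s => partialCov (α + 1) (mv (U s.1)ᵀ (normalized (fitted (X s.1) (y s.1))))
          (sketchGram (S s.1 s.2) (U s.1))) ?_ (fun n => ?_) ?_
      · refine tendsto_partialCov_sub _ ?_ hG
        filter_upwards [hge] with s h2
        exact (hX _ h2).norm_mv_transpose_normalized_fitted (hε _ h2)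
      · exact measurable_studentized_partialSketch (hS n) (X n) (y n) _ hα0
      · filter_upwards [hdet, hge] with s h1 h2
        have hpos : 0 < ‖fitted (X s.1) (y s.1)‖ := norm_pos_iff.2 (hε _ h2)
        rw [(hX' _ h2).partialSketch_cov_eq, (hX' _ h2).partialSketch_sub_lsCoef h1, ← neg_smul,
          inv_neg, neg_mul, neg_neg, abs_neg, abs_of_pos (hℓ _ h2)]
        exact smul_mv_inv_matSqrt_eq_mv_studentizer (posSemidef_partialCov hα0 _ _ _) _ _
          (mul_pos (inv_pos.2 (hℓ _ h2)) hpos) _ _
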